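/- Let $n,m\ge 0$ be integers, $A\in\mathbb{R}^{(n+1)\times(n+1)}$, $C\in\mathbb{R}^{1\times(n+1)}$, $F\in\mathbb{R}^{m\times m}$, $G\in\mathbb{R}^{m\times1}$, $H\in\mathbb{R}^{1\times m}$. Assume that $F$ and $F-GH$ have all their eigenvalues in the open unit disk (that is, the noise filter $\mathcal{Z}(z)$, whose inverse has the state-space realization $(F,G,H,1)$, is stable and minimum-phase), that $(F,G)$ is controllable, $(F,H)$ and $(A,C)$ are observable, and that no eigenvalue of $A$ lies on the unit circle or is an eigenvalue of $F$. Put $$\mathbb{A}=\begin{bmatrix}A&0\\GC&F\end{bmatrix},\quad \mathbb{C}=[\,C\ \ H\,],\quad \mathbb{D}=[\,C\ \ 0\,],\quad \Sigma_0=\begin{bmatrix}I_{n+1}&0\\0&0\end{bmatrix},$$ and for a symmetric $\Sigma$ put $K(\Sigma)=\mathbb{C}\Sigma\mathbb{C}'+1$ and $L(\Sigma)=\mathbb{A}\Sigma\mathbb{C}'/K(\Sigma)$. Consider the Riccati recursion $$\Sigma_{t+1}=\mathbb{A}\Sigma_t\mathbb{A}'-\frac{\mathbb{A}\Sigma_t\mathbb{C}'\mathbb{C}\Sigma_t\mathbb{A}'}{\mathbb{C}\Sigma_t\mathbb{C}'+1}\qquad(t\ge0)$$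 started at $\Sigma_0$. A stabilizing solution of the Riccati equation is a real symmetric $\Sigma$ with $K(\Sigma)\neq0$ that is a fixed point of this recursion and for which all eigenvalues of $\mathbb{A}-L(\Sigma)\mathbb{C}$ lie in the open unit disk. (i) The sequence $\Sigma_t$ converges to a positive semidefinite matrix $\Sigma_\infty$, and $\Sigma_\infty$ is the unique stabilizing solution of the Riccati equation. If all eigenvalues of $A$ have modulus greater than $1$, then $\Sigma_\infty$ has rank $n+1$. (ii) Let $L_t=L(\Sigma_t)$ and $L=L(\Sigma_\infty)$. The time-varying system $$\mathbb{X}_{t+1}=(\mathbb{A}-L_t\mathbb{C})\mathbb{X}_t-L_tN_t,\quad e_t=\mathbb{C}\mathbb{X}_t+N_t,\quad u_t=\mathbb{D}\mathbb{X}_t$$ converges to the time-invariant steady-state system $$\bar{\mathbb{X}}_{t+1}=(\mathbb{A}-L\mathbb{C})\bar{\mathbb{X}}_t-LN_t,\quad \bar e_t=\mathbb{C}\bar{\mathbb{X}}_t+N_t,\quad \bar u_t=\mathbb{D}\bar{\mathbb{X}}_t$$ in the following sense. (a) $L_t\to L$, $K(\Sigma_t)\to K(\Sigma_\infty)$ and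 $\mathbb{A}-L_t\mathbb{C}\to\mathbb{A}-L\mathbb{C}$. (b) The steady-state system, driven by standard normal noise $N_t$ independent of $\bar{\mathbb{X}}_t$, has exactly one stationary state distribution, namely $\mathcal{N}(0,\Sigma_\infty)$. (c) Let $W\sim\mathcal{N}(0,I_{n+1})$ be independent of the i.i.d. standard normal sequence $(N_t)_{t\ge0}$. If both systems are driven by $(N_t)$ and started from arbitrary square-integrable random vectors $\mathbb{X}_0$ and $\bar{\mathbb{X}}_0$, then $\mathbb{X}_t-\bar{\mathbb{X}}_t$, $e_t-\bar e_t$ and $u_t-\bar u_t$ converge to $0$ in mean square. If $\mathbb{X}_0=[W',0]'$, then $\mathbb{X}_t$, $e_t$ and $u_t$ converge in distribution to $\mathcal{N}(0,\Sigma_\infty)$, $\mathcal{N}(0,\mathbb{C}\Sigma_\infty\mathbb{C}'+1)$ and $\mathcal{N}(0,\mathbb{D}\Sigma_\infty\mathbb{D}')$, respectively. -/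

import Mathlib

open Matrix MeasureTheory ProbabilityTheory Filter Topology

noncomputable section

namespace FeedbackKalman

/-- The set of complex eigenvalues of a real square matrix. -/
def eigs {ι : Type*} [Fintype ι] [DecidableEq ι] (M : Matrix ι ι ℝ) : Set ℂ :=
  spectrum ℂ (M.map Complex.ofReal)

/-- Discrete-time stability: every eigenvalue lies in the open unit disk. -/
def IsSchurStable {ι : Type*} [Fintype ι] [DecidableEq ι] (M : Matrix ι ι ℝ) : Prop :=
  ∀ z ∈ eigs M, ‖z‖ < 1

/-- Observability of the pair `(A, c)`, where `c` is a row vector: the square matrix with rows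
`c, c A, …, c A ^ (k - 1)` is invertible. -/
def IsObservable {k : ℕ} (A : Matrix (Fin k) (Fin k) ℝ) (c : Fin k → ℝ) : Prop :=
  IsUnit (Matrix.of fun i j : Fin k => (c ᵥ* A ^ (i : ℕ)) j)

/-- Controllability of the pair `(A, b)`, where `b` is a column vector: the square matrix with
columns `b, A b, …, A ^ (k - 1) b` is invertible. -/
def IsControllable {k : ℕ} (A : Matrix (Fin k) (Fin k) ℝ) (b : Fin k → ℝ) : Prop :=
  IsUnit (Matrix.of fun i j : Fin k => (A ^ (j : ℕ) *ᵥ b) i)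

section Block

variable {n m : ℕ}

/-- The block matrix `[[A, 0], [G C, F]]`. -/
def bigA (A : Matrix (Fin (n + 1)) (Fin (n + 1)) ℝ) (C : Fin (n + 1) → ℝ)
    (F : Matrix (Fin m) (Fin m) ℝ) (G : Fin m → ℝ) :
    Matrix (Fin (n + 1) ⊕ Fin m) (Fin (n + 1) ⊕ Fin m) ℝ :=
  Matrix.fromBlocks A 0 (Matrix.vecMulVec G C) F

/-- The row vector `[C, H]`. -/
def bigC (C : Fin (n + 1) → ℝ) (H : Fin m → ℝ) : Fin (n + 1) ⊕ Fin m → ℝ :=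
  Sum.elim C H

/-- The row vector `[C, 0]`. -/
def bigD (m : ℕ) (C : Fin (n + 1) → ℝ) : Fin (n + 1) ⊕ Fin m → ℝ :=
  Sum.elim C 0

/-- The initial covariance `diag(I, 0)`. -/
def sigmaZero (n m : ℕ) : Matrix (Fin (n + 1) ⊕ Fin m) (Fin (n + 1) ⊕ Fin m) ℝ :=
  Matrix.fromBlocks 1 0 0 0

end Block

section Riccati

variable {ι : Type*} [Fintype ι]

/-- The innovation variance `c S cᵀ + 1`. -/
def innovVar (c : ι → ℝ) (S : Matrix ι ι ℝ) : ℝ :=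
  c ⬝ᵥ (S *ᵥ c) + 1

/-- The gain `M S cᵀ / (c S cᵀ + 1)`. -/
def gain (M : Matrix ι ι ℝ) (c : ι → ℝ) (S : Matrix ι ι ℝ) : ι → ℝ :=
  (innovVar c S)⁻¹ • (M *ᵥ (S *ᵥ c))

/-- The Riccati map `S ↦ M S Mᵀ - (M S cᵀ) (c S Mᵀ) / (c S cᵀ + 1)`. -/
def riccatiMap (M : Matrix ι ι ℝ) (c : ι → ℝ) (S : Matrix ι ι ℝ) : Matrix ι ι ℝ :=
  M * S * Mᵀ - (innovVar c S)⁻¹ • Matrix.vecMulVec (M *ᵥ (S *ᵥ c)) ((c ᵥ* S) ᵥ* Mᵀ)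

/-- The Riccati recursion started from `S₀`. -/
def riccatiSeq (M : Matrix ι ι ℝ) (c : ι → ℝ) (S₀ : Matrix ι ι ℝ) : ℕ → Matrix ι ι ℝ
  | 0 => S₀
  | t + 1 => riccatiMap M c (riccatiSeq M c S₀ t)

/-- The closed-loop matrix `M - L c` for a column vector `L` and a row vector `c`. -/
def closedLoop (M : Matrix ι ι ℝ) (c : ι → ℝ) (L : ι → ℝ) : Matrix ι ι ℝ :=
  M - Matrix.vecMulVec L c

/-- A stabilizing solution of the discrete algebraic Riccati equation: a symmetric fixed point of
the Riccati map (with nonzero denominator) whose gain makes the closed-loop matrix stable. -/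
structure IsStabilizingSolution [DecidableEq ι] (M : Matrix ι ι ℝ) (c : ι → ℝ) (S : Matrix ι ι ℝ) : Prop where
  symm : S.IsSymm
  denom : innovVar c S ≠ 0
  eq : S = riccatiMap M c S
  stable : IsSchurStable (closedLoop M c (gain M c S))

/-- The state of `X_{t+1} = (M - L_t c) X_t - L_t N_t`, `X_0 = x₀`, along one noise path `N`. -/
def stateSeq (M : Matrix ι ι ℝ) (c : ι → ℝ) (L : ℕ → ι → ℝ) (x₀ : ι → ℝ) (N : ℕ → ℝ) :
    ℕ → ι → ℝ
  | 0 => x₀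
  | t + 1 => closedLoop M c (L t) *ᵥ stateSeq M c L x₀ N t - N t • L t

/-- The innovation `e_t = c X_t + N_t`. -/
def innovSeq (M : Matrix ι ι ℝ) (c : ι → ℝ) (L : ℕ → ι → ℝ) (x₀ : ι → ℝ) (N : ℕ → ℝ)
    (t : ℕ) : ℝ :=
  c ⬝ᵥ stateSeq M c L x₀ N t + N t

/-- The output `u_t = d X_t`. -/
def inputSeq (M : Matrix ι ι ℝ) (c d : ι → ℝ) (L : ℕ → ι → ℝ) (x₀ : ι → ℝ) (N : ℕ → ℝ)
    (t : ℕ) : ℝ :=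
  d ⬝ᵥ stateSeq M c L x₀ N t

/-- `μ` is a stationary law of `X_{t+1} = (M - L c) X_t - L N_t`, where `N_t` is standard normal
and independent of `X_t`. -/
def IsStationaryLaw (M : Matrix ι ι ℝ) (c : ι → ℝ) (L : ι → ℝ)
    (μ : Measure (EuclideanSpace ℝ ι)) : Prop :=
  (μ.prod (gaussianReal 0 1)).map
    (fun p => WithLp.toLp 2 (closedLoop M c L *ᵥ p.1.ofLp - p.2 • L)) = μ

end Riccati

end FeedbackKalman

end

open Matrix MeasureTheory ProbabilityTheory Filter Topology

noncomputable section

namespace FeedbackKalman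

section

variable {ι : Type*} [Fintype ι]

/-! ### Schur stability: decay of powers, eigenvalues of blocks and of limits -/

section Stability

variable [DecidableEq ι]

/-! Write `M`, `c` for the block system, `Y(S)` for the closed loop with gain `gain M c S`, and `Y`
for `Y(S)` at the stabilizing solution. Completing squares (`closedLoop_mul_mul_transpose`) shows
that the Riccati map is the minimum over gains `L` of the monotone affine maps sending `S` to `(M -
Lc) S (M - Lc)ᵀ + L Lᵀ`. Hence it preserves positivity, is monotone, and is bounded along the
recursion as soon as one gain stabilizes `M - Lc`. Such a gain stacks a deadbeat observer gain for
`(A, C)` on `G`.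

Existence: with extra process noise `ε • 1` the iteration from zero increases to a fixed point whose
closed loop is stable by Lyapunov's argument. A limit point as `ε → 0` is a fixed point with
closed-loop spectrum in the closed disk. An eigenvector of `Yᵀ` on the unit circle would be
orthogonal to the gain, hence an eigenvector of `Mᵀ`, which is excluded.

Uniqueness and convergence both come from the exact identity `riccatiMap_sub`: the difference of two
images is `Y(S) (S - S') Y(S')ᵀ`. Iterated, it gives `Σ_t - S = Φ_t (Σ_0 - S) (Y ^ t)ᵀ`, where `Φ_t`
is the time-varying transition matrix, so bounded `Φ_t` suffices. Since `Σ_0` is singular, `Φ_t Σ_0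
Φ_tᵀ ≤ Σ_t` does not bound every column. Each column is therefore compared with an open-loop
trajectory `(0, F ^ t y)`, which decays; the remainder starts in the range of `Σ_0` and is driven
along the gains by square-summable inputs, so a Cauchy–Schwarz estimate against `Σ_t` bounds it
(`exists_closedProd_bound`).

Rank, for antistable `A`: a Sylvester solution gives an `Mᵀ`-invariant complement on which `Mᵀ` acts
as `Fᵀ`, and `S` kills it; on vectors `(x, 0)` the kernel of `S` is trivial, because there `Yᵀ`
would act as the expanding `Aᵀ`.

Signals: the state difference obeys a stable recursion with vanishing perturbation. All laws are
handled by characteristic functions, whose quadratic exponents evolve by the Riccati recursion. -/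

open scoped Matrix.Norms.Operator in
-- Gelfand's formula: `‖M ^ t‖ ^ (1 / t)` tends to the spectral radius, so it is eventually below
-- some `r < 1`.
theorem exists_pow_norm_le_of_spectrum [Nonempty ι] (M : Matrix ι ι ℂ)
    (hM : ∀ z ∈ spectrum ℂ M, ‖z‖ < 1) :
    ∃ C ρ : ℝ, 0 < ρ ∧ ρ < 1 ∧ ∀ t, ‖M ^ t‖ ≤ C * ρ ^ t := by
  have hr : spectralRadius ℂ M < (1 : NNReal) :=
    spectrum.spectralRadius_lt_of_forall_lt M fun z hz => by
      have := hM z hz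
      exact_mod_cast this
  obtain ⟨r, hr1, hr2⟩ := ENNReal.lt_iff_exists_nnreal_btwn.1 hr
  have hr2' : (r : ℝ) < 1 := by exact_mod_cast hr2
  have hr0 : 0 < (r : ℝ) := by
    have : (0 : ENNReal) < r := lt_of_le_of_lt (zero_le) hr1
    exact_mod_cast this
  have hev := (spectrum.pow_nnnorm_pow_one_div_tendsto_nhds_spectralRadius M).eventually
    (gt_mem_nhds hr1)
  obtain ⟨k, hk⟩ := eventually_atTop.1 (hev.and (eventually_gt_atTop 0))
  have hbig : ∀ t ≥ k, ‖M ^ t‖ ≤ (r : ℝ) ^ t := by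
    intro t ht
    obtain ⟨h1, h2⟩ := hk t ht
    have h3 : (‖M ^ t‖₊ : ENNReal) ≤ (r : ENNReal) ^ t := by
      have := ENNReal.rpow_le_rpow h1.le (z := (t : ℝ)) (by positivity)
      rw [← ENNReal.rpow_mul, one_div, inv_mul_cancel₀ (by positivity), ENNReal.rpow_one,
        ENNReal.rpow_natCast] at this
      exact this
    exact_mod_cast h3
  -- The sum absorbs the finitely many powers before the geometric bound sets in.
  refine ⟨1 + ∑ s ∈ Finset.range k, ‖M ^ s‖ / (r : ℝ) ^ s, r, hr0, hr2', fun t => ?_⟩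
  have hnn : ∀ s ∈ Finset.range k, 0 ≤ ‖M ^ s‖ / (r : ℝ) ^ s := fun s _ => by positivity
  rcases lt_or_ge t k with h | h
  · have := Finset.single_le_sum hnn (Finset.mem_range.2 h)
    have h' : ‖M ^ t‖ = ‖M ^ t‖ / (r : ℝ) ^ t * (r : ℝ) ^ t := by field_simp
    rw [h']
    gcongr
    linarith
  · refine (hbig t h).trans ?_
    have := Finset.sum_nonneg hnn
    have hp : 0 < (r : ℝ) ^ t := by positivity
    nlinarith

open scoped Matrix.Norms.Operator in
theorem norm_entry_le (M : Matrix ι ι ℂ) (i j : ι) : ‖M i j‖ ≤ ‖M‖ := by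
  have h := Matrix.linfty_opNorm_mulVec M (Pi.single j 1)
  have h2 : ‖(Pi.single j 1 : ι → ℂ)‖ = 1 := by
    rw [Pi.norm_single, norm_one]
  rw [h2, mul_one] at h
  refine le_trans ?_ ((norm_le_pi_norm (M *ᵥ Pi.single j 1) i).trans h)
  simp

theorem IsSchurStable.exists_pow_bound {M : Matrix ι ι ℝ} (hM : IsSchurStable M) :
    ∃ C ρ : ℝ, 0 ≤ C ∧ 0 < ρ ∧ ρ < 1 ∧ ∀ t i j, |(M ^ t) i j| ≤ C * ρ ^ t := by
  cases isEmpty_or_nonempty ι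
  · exact ⟨0, 1 / 2, le_rfl, by norm_num, by norm_num, fun _ i => isEmptyElim i⟩
  obtain ⟨C, ρ, h0, h1, h⟩ := exists_pow_norm_le_of_spectrum (M.map Complex.ofReal) hM
  have hb : ∀ t i j, |(M ^ t) i j| ≤ C * ρ ^ t := by
    intro t i j
    refine le_trans ?_ (h t)
    have := norm_entry_le (M.map Complex.ofReal ^ t) i j
    have hmap : M.map Complex.ofReal ^ t = (M ^ t).map Complex.ofReal :=
      (Matrix.map_pow M Complex.ofRealHom t).symm
    rwa [show (M.map Complex.ofReal ^ t) i j = (((M ^ t) i j : ℝ) : ℂ) by rw [hmap]; rfl,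
      Complex.norm_real] at this
  refine ⟨C, ρ, ?_, h0, h1, hb⟩
  have i : ι := Classical.arbitrary ι
  have := hb 0 i i
  simp at this
  linarith

theorem IsSchurStable.tendsto_pow {M : Matrix ι ι ℝ} (hM : IsSchurStable M) :
    Tendsto (fun t => M ^ t) atTop (𝓝 0) := by
  obtain ⟨C, ρ, hC, h0, h1, h⟩ := hM.exists_pow_bound
  refine tendsto_pi_nhds.2 fun i => tendsto_pi_nhds.2 fun j => ?_
  refine squeeze_zero_norm (fun t => h t i j) ?_
  simpa using (tendsto_pow_atTop_nhds_zero_of_lt_one h0.le h1).const_mul C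

theorem mem_eigs_iff_charpoly {M : Matrix ι ι ℝ} {z : ℂ} :
    z ∈ eigs M ↔ (M.map Complex.ofReal).charpoly.IsRoot z :=
  Matrix.mem_spectrum_iff_isRoot_charpoly

theorem eigs_transpose (M : Matrix ι ι ℝ) : eigs Mᵀ = eigs M := by
  ext z
  rw [mem_eigs_iff_charpoly, mem_eigs_iff_charpoly, ← Matrix.charpoly_transpose (M.map _)]
  rfl

theorem IsSchurStable.transpose {M : Matrix ι ι ℝ} (hM : IsSchurStable M) : IsSchurStable Mᵀ := by
  rwa [IsSchurStable, eigs_transpose]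

theorem mem_eigs_iff_exists {M : Matrix ι ι ℝ} {z : ℂ} :
    z ∈ eigs M ↔ ∃ v : ι → ℂ, v ≠ 0 ∧ M.map Complex.ofReal *ᵥ v = z • v := by
  rw [eigs, ← Matrix.spectrum_toLin', ← Module.End.hasEigenvalue_iff_mem_spectrum]
  constructor
  · intro h
    obtain ⟨v, hv⟩ := h.exists_hasEigenvector
    exact ⟨v, hv.2, by simpa using hv.apply_eq_smul⟩
  · rintro ⟨v, hv, h⟩
    exact Module.End.hasEigenvalue_of_hasEigenvector
      ⟨Module.End.mem_eigenspace_iff.2 (by simpa using h), hv⟩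

theorem eigs_fromBlocks_zero₂₁ {κ : Type*} [Fintype κ] [DecidableEq κ] (A : Matrix ι ι ℝ)
    (B : Matrix ι κ ℝ) (D : Matrix κ κ ℝ) :
    eigs (Matrix.fromBlocks A B 0 D) = eigs A ∪ eigs D := by
  ext z
  rw [Set.mem_union, mem_eigs_iff_charpoly, mem_eigs_iff_charpoly, mem_eigs_iff_charpoly,
    Matrix.fromBlocks_map, Matrix.map_zero _ Complex.ofReal_zero,
    Matrix.charpoly_fromBlocks_zero₂₁, Polynomial.root_mul]

theorem eigs_fromBlocks_zero₁₂ {κ : Type*} [Fintype κ] [DecidableEq κ] (A : Matrix ι ι ℝ)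
    (B : Matrix κ ι ℝ) (D : Matrix κ κ ℝ) :
    eigs (Matrix.fromBlocks A 0 B D) = eigs A ∪ eigs D := by
  rw [← eigs_transpose, Matrix.fromBlocks_transpose, Matrix.transpose_zero,
    eigs_fromBlocks_zero₂₁, eigs_transpose, eigs_transpose]

theorem isSchurStable_of_pow_eq_zero {M : Matrix ι ι ℝ} {k : ℕ} (h : M ^ k = 0) :
    IsSchurStable M := by
  intro z hz
  obtain ⟨v, hv, hz⟩ := mem_eigs_iff_exists.1 hz
  have hpow : ∀ t : ℕ, (M.map Complex.ofReal ^ t) *ᵥ v = z ^ t • v := by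
    intro t
    induction t with
    | zero => simp
    | succ t ih => rw [pow_succ, ← Matrix.mulVec_mulVec, hz, Matrix.mulVec_smul, ih, smul_smul,
        ← pow_succ']
  have h1 := hpow k
  rw [show M.map Complex.ofReal ^ k = (M ^ k).map Complex.ofReal from
      (Matrix.map_pow M Complex.ofRealHom k).symm, h, Matrix.map_zero _ Complex.ofReal_zero,
      Matrix.zero_mulVec] at h1
  have h2 : z ^ k = 0 := by
    by_contra h3
    exact (smul_ne_zero h3 hv) h1.symm
  simp [eq_zero_of_pow_eq_zero h2]

/-- Each root lies in the unit disk, so each linear factor at `z` has modulus at least `‖z‖ - 1`.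
The bound is uniform over stable matrices and so survives limits, replacing continuity of
eigenvalues. -/
theorem pow_le_norm_charpoly_eval {M : Matrix ι ι ℝ} (hM : IsSchurStable M) {z : ℂ}
    (hz : 1 ≤ ‖z‖) :
    (‖z‖ - 1) ^ Fintype.card ι ≤ ‖(M.map Complex.ofReal).charpoly.eval z‖ := by
  set p := (M.map Complex.ofReal).charpoly with hp
  have hs := IsAlgClosed.splits p
  have key : ∀ s : Multiset ℂ, (∀ x ∈ s, ‖x‖ < 1) →
      (‖z‖ - 1) ^ s.card ≤ ‖(s.map fun x => z - x).prod‖ := by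
    intro s
    induction s using Multiset.induction_on with
    | empty => simp
    | cons a s ih =>
      intro h
      rw [Multiset.card_cons, pow_succ', Multiset.map_cons, Multiset.prod_cons, norm_mul]
      have h1 := h a (Multiset.mem_cons_self a s)
      have h2 := norm_sub_norm_le z a
      exact mul_le_mul (by linarith) (ih fun x hx => h x (Multiset.mem_cons_of_mem hx))
        (pow_nonneg (by linarith) _) (norm_nonneg _)
  have hcard : p.roots.card = Fintype.card ι := by
    rw [← hs.natDegree_eq_card_roots, hp, Matrix.charpoly_natDegree_eq_dim]
  rw [hs.eval_eq_prod_roots_of_monic (Matrix.charpoly_monic _), ← hcard]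
  exact key _ fun x hx => hM x (mem_eigs_iff_charpoly.2 (Polynomial.isRoot_of_mem_roots hx))

theorem norm_le_one_of_tendsto {M : ℕ → Matrix ι ι ℝ} {M' : Matrix ι ι ℝ}
    (h : Tendsto M atTop (𝓝 M')) (hM : ∀ k, IsSchurStable (M k)) {z : ℂ} (hz : z ∈ eigs M') :
    ‖z‖ ≤ 1 := by
  by_contra! hz1
  have hc : Continuous fun N : Matrix ι ι ℝ => ‖(N.map Complex.ofReal).charpoly.eval z‖ := by
    simp only [Matrix.eval_charpoly]
    have : Continuous fun N : Matrix ι ι ℝ => N.map Complex.ofReal :=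
      continuous_id.matrix_map Complex.continuous_ofReal
    fun_prop
  have h1 := ge_of_tendsto (hc.continuousAt.tendsto.comp h)
    (Eventually.of_forall fun k => pow_le_norm_charpoly_eval (hM k) hz1.le)
  rw [(mem_eigs_iff_charpoly.1 hz).eq_zero, norm_zero] at h1
  exact absurd h1 (not_le.2 (pow_pos (by linarith) _))

end Stability

end


/-! ### Real quadratic forms and the positive semidefinite order -/

section

variable {ι : Type*} [Fintype ι]

theorem dotProduct_conj_mulVec (Y S : Matrix ι ι ℝ) (w u : ι → ℝ) :
    w ⬝ᵥ ((Y * S * Yᵀ) *ᵥ u) = (Yᵀ *ᵥ w) ⬝ᵥ (S *ᵥ (Yᵀ *ᵥ u)) := by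
  rw [← Matrix.mulVec_mulVec, ← Matrix.mulVec_mulVec, Matrix.dotProduct_mulVec, ← Matrix.mulVec_transpose]

theorem dotProduct_vecMulVec_mulVec (a b w u : ι → ℝ) :
    w ⬝ᵥ (vecMulVec a b *ᵥ u) = (a ⬝ᵥ w) * (b ⬝ᵥ u) := by
  rw [Matrix.vecMulVec_mulVec]
  simp [dotProduct_comm a w, mul_comm]

theorem posSemidef_iff_isSymm {S : Matrix ι ι ℝ} :
    S.PosSemidef ↔ S.IsSymm ∧ ∀ w, 0 ≤ w ⬝ᵥ (S *ᵥ w) := by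
  rw [Matrix.posSemidef_iff_dotProduct_mulVec]
  simp [Matrix.IsHermitian, Matrix.IsSymm]

theorem _root_.Matrix.PosSemidef.isSymm {S : Matrix ι ι ℝ} (hS : S.PosSemidef) : S.IsSymm :=
  (posSemidef_iff_isSymm.1 hS).1

theorem _root_.Matrix.PosSemidef.quad_nonneg {S : Matrix ι ι ℝ} (hS : S.PosSemidef) (w : ι → ℝ) :
    0 ≤ w ⬝ᵥ (S *ᵥ w) :=
  (posSemidef_iff_isSymm.1 hS).2 w

theorem posSemidef_conj {S : Matrix ι ι ℝ} (hS : S.PosSemidef) (Y : Matrix ι ι ℝ) :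
    (Y * S * Yᵀ).PosSemidef := by
  simpa using hS.mul_mul_conjTranspose_same Y

theorem posSemidef_vecMulVec (l : ι → ℝ) : (vecMulVec l l).PosSemidef := by
  simpa using Matrix.posSemidef_vecMulVec_self_star l

/-- Testing on `e_i ± e_j` bounds the entry by diagonal ones. Order intervals thus lie in a compact
box. -/
theorem abs_entry_le {S P : Matrix ι ι ℝ} [DecidableEq ι] (hS : S.PosSemidef)
    (hP : (P - S).PosSemidef) (i j : ι) : |S i j| ≤ P i i + P j j := by
  have h1 := hS.quad_nonneg (Pi.single i 1 + Pi.single j 1)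
  have h2 := hS.quad_nonneg (Pi.single i 1 - Pi.single j 1)
  have h3 := hP.quad_nonneg (Pi.single i 1)
  have h4 := hP.quad_nonneg (Pi.single j 1)
  have h5 := hS.quad_nonneg (Pi.single i 1)
  have h6 := hS.quad_nonneg (Pi.single j 1)
  have hs := hS.isSymm.apply i j
  simp [Matrix.mulVec_add, Matrix.mulVec_sub] at h1 h2 h3 h4 h5 h6
  rw [abs_le]
  constructor <;> linarith

theorem isClosed_posSemidef : IsClosed {S : Matrix ι ι ℝ | S.PosSemidef} := by
  have : {S : Matrix ι ι ℝ | S.PosSemidef} = {S | Sᵀ = S} ∩ ⋂ w : ι → ℝ, {S | 0 ≤ w ⬝ᵥ (S *ᵥ w)} := by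
    ext S
    simp [posSemidef_iff_isSymm, Matrix.IsSymm]
  rw [this]
  refine (isClosed_eq (by fun_prop) (by fun_prop)).inter (isClosed_iInter fun w => ?_)
  exact isClosed_le (by fun_prop) (by fun_prop)

/-! ### The Lyapunov equation -/

section Lyapunov

variable [DecidableEq ι]

/-- Here `x + iy` is the eigenvector; the real form lets real quadratic forms be tested on it. -/
theorem mem_eigs_iff_real {M : Matrix ι ι ℝ} {z : ℂ} :
    z ∈ eigs M ↔ ∃ x y : ι → ℝ, (x ≠ 0 ∨ y ≠ 0) ∧ M *ᵥ x = z.re • x - z.im • y ∧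
      M *ᵥ y = z.im • x + z.re • y := by
  rw [mem_eigs_iff_exists]
  have key : ∀ v : ι → ℂ, M.map Complex.ofReal *ᵥ v = z • v ↔
      (M *ᵥ (fun i => (v i).re) = z.re • (fun i => (v i).re) - z.im • (fun i => (v i).im) ∧
      M *ᵥ (fun i => (v i).im) = z.im • (fun i => (v i).re) + z.re • (fun i => (v i).im)) := by
    intro v
    simp only [funext_iff, Complex.ext_iff, Matrix.mulVec, dotProduct, Matrix.map_apply,
      Complex.re_sum, Complex.im_sum, Complex.mul_re, Complex.mul_im, Complex.ofReal_re,
      Complex.ofReal_im, zero_mul, sub_zero, add_zero, Pi.smul_apply, smul_eq_mul, Pi.sub_apply,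
      Pi.add_apply, ← forall_and]
    refine forall_congr' fun i => ?_
    rw [add_comm (z.re * (v i).im)]
  constructor
  · rintro ⟨v, hv, h⟩
    refine ⟨_, _, ?_, (key v).1 h⟩
    by_contra! h0
    refine hv (funext fun i => Complex.ext (congrFun h0.1 i) (congrFun h0.2 i))
  · rintro ⟨x, y, h0, h⟩
    refine ⟨fun i => ⟨x i, y i⟩, ?_, (key _).2 h⟩
    intro hv
    rcases h0 with h0 | h0
    · exact h0 (funext fun i => congrArg Complex.re (congrFun hv i))
    · exact h0 (funext fun i => congrArg Complex.im (congrFun hv i))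

/-- The Lyapunov identity tested against the real and imaginary parts of an eigenvector. -/
theorem lyapunov_eigenvector {S Y : Matrix ι ι ℝ} {l : ι → ℝ} {ε : ℝ}
    (h : S = Y * S * Yᵀ + vecMulVec l l + ε • 1) {z : ℂ} {x y : ι → ℝ}
    (hx : Yᵀ *ᵥ x = z.re • x - z.im • y) (hy : Yᵀ *ᵥ y = z.im • x + z.re • y) :
    (1 - ‖z‖ ^ 2) * (x ⬝ᵥ (S *ᵥ x) + y ⬝ᵥ (S *ᵥ y)) =
      (l ⬝ᵥ x) ^ 2 + (l ⬝ᵥ y) ^ 2 + ε * (x ⬝ᵥ x + y ⬝ᵥ y) := by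
  have hq : ∀ w, w ⬝ᵥ (S *ᵥ w) =
      (Yᵀ *ᵥ w) ⬝ᵥ (S *ᵥ (Yᵀ *ᵥ w)) + (l ⬝ᵥ w) ^ 2 + ε * (w ⬝ᵥ w) := by
    intro w
    conv_lhs => rw [h]
    rw [Matrix.add_mulVec, Matrix.add_mulVec, dotProduct_add, dotProduct_add,
      dotProduct_conj_mulVec, dotProduct_vecMulVec_mulVec, Matrix.smul_mulVec, Matrix.one_mulVec,
      dotProduct_smul, smul_eq_mul, sq]
  have h1 := hq x
  have h2 := hq y
  rw [hx] at h1
  rw [hy] at h2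
  simp only [Matrix.mulVec_add, Matrix.mulVec_sub, Matrix.mulVec_smul, dotProduct_add,
    add_dotProduct, sub_dotProduct, dotProduct_sub, smul_dotProduct, dotProduct_smul,
    smul_eq_mul] at h1 h2
  have hz : ‖z‖ ^ 2 = z.re ^ 2 + z.im ^ 2 := by
    rw [← Complex.normSq_eq_norm_sq, Complex.normSq_apply]; ring
  rw [hz]
  linear_combination h1 + h2

/-- In `lyapunov_eigenvector`, `1 ≤ ‖z‖` makes the left side nonpositive, while the `ε` term makes
the right side positive. -/
theorem isSchurStable_of_lyapunov {S Y : Matrix ι ι ℝ} {l : ι → ℝ} {ε : ℝ} (hε : 0 < ε)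
    (hS : S.PosSemidef) (h : S = Y * S * Yᵀ + vecMulVec l l + ε • 1) : IsSchurStable Y := by
  intro z hz
  rw [← eigs_transpose, mem_eigs_iff_real] at hz
  obtain ⟨x, y, h0, hx, hy⟩ := hz
  have h1 := lyapunov_eigenvector h hx hy
  have h2 := hS.quad_nonneg x
  have h3 := hS.quad_nonneg y
  have hpos : ∀ v : ι → ℝ, v ≠ 0 → 0 < v ⬝ᵥ v := fun v hv => by
    simpa using Matrix.dotProduct_star_self_pos_iff.2 hv
  have hnn : ∀ v : ι → ℝ, 0 ≤ v ⬝ᵥ v := fun v =>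
    Finset.sum_nonneg fun i _ => mul_self_nonneg (v i)
  have h4 : 0 < x ⬝ᵥ x + y ⬝ᵥ y := by
    rcases h0 with h0 | h0
    · linarith [hpos x h0, hnn y]
    · linarith [hpos y h0, hnn x]
  by_contra! h5
  have : 0 < ε * (x ⬝ᵥ x + y ⬝ᵥ y) := by positivity
  nlinarith [sq_nonneg (l ⬝ᵥ x), sq_nonneg (l ⬝ᵥ y), mul_nonneg (sub_nonneg.2 (one_le_pow₀ h5 (n := 2))) (add_nonneg h2 h3)]

/-- The solution is the series `∑ Y ^ s R (Y ^ s)ᵀ`, dominated entrywise by a geometric series. -/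
theorem exists_lyapunov {Y R : Matrix ι ι ℝ} (hY : IsSchurStable Y) (hR : R.PosSemidef) :
    ∃ P : Matrix ι ι ℝ, P.PosSemidef ∧ P = Y * P * Yᵀ + R := by
  obtain ⟨C, ρ, hC, h0, h1, hb⟩ := hY.exists_pow_bound
  set T : ℕ → Matrix ι ι ℝ := fun s => Y ^ s * R * (Y ^ s)ᵀ with hT
  have hTs : Summable T := by
    refine Pi.summable.2 fun i => Pi.summable.2 fun j => ?_
    refine Summable.of_norm_bounded (g := fun s : ℕ => (∑ a, ∑ b, C * |R b a| * C) * (ρ ^ 2) ^ s)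
      ((summable_geometric_of_lt_one (by positivity) (by nlinarith)).mul_left _) fun s => ?_
    simp only [hT, Matrix.mul_apply, Matrix.transpose_apply, Real.norm_eq_abs, Finset.sum_mul]
    refine (Finset.abs_sum_le_sum_abs _ _).trans (Finset.sum_le_sum fun a _ => ?_)
    refine (Finset.abs_sum_le_sum_abs _ _).trans (Finset.sum_le_sum fun b _ => ?_)
    rw [abs_mul, abs_mul]
    calc |(Y ^ s) i b| * |R b a| * |(Y ^ s) j a| ≤ (C * ρ ^ s) * |R b a| * (C * ρ ^ s) := by
          gcongr <;> apply hb
      _ = _ := by ring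
  have hTp : ∀ s, (T s).PosSemidef := fun s => posSemidef_conj hR _
  have hsucc : ∀ s, T (s + 1) = Y * T s * Yᵀ := fun s => by
    simp only [hT, pow_succ', Matrix.transpose_mul, Matrix.mul_assoc]
  refine ⟨∑' s, T s, ?_, ?_⟩
  · refine isClosed_posSemidef.mem_of_tendsto hTs.hasSum.tendsto_sum_nat
      (Eventually.of_forall fun k => ?_)
    exact Matrix.posSemidef_sum _ fun s _ => hTp s
  · conv_lhs => rw [hTs.tsum_eq_zero_add]
    rw [add_comm]
    congr 1
    · simp_rw [hsucc]
      let f : Matrix ι ι ℝ →+ Matrix ι ι ℝ := AddMonoidHom.mk' (fun X => Y * X * Yᵀ) fun X Z => by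
        rw [Matrix.mul_add, Matrix.add_mul]
      have hf : Continuous f := by
        change Continuous fun X : Matrix ι ι ℝ => Y * X * Yᵀ
        fun_prop
      exact (hTs.map_tsum f hf).symm
    · simp [hT]

end Lyapunov

end


section

variable {ι : Type*} [Fintype ι]

/-! ### Algebra of the Riccati map -/

section RiccatiAlgebra

variable {M : Matrix ι ι ℝ} {c : ι → ℝ} {S : Matrix ι ι ℝ}

theorem one_le_innovVar (hS : S.PosSemidef) : 1 ≤ innovVar c S := by
  have := hS.quad_nonneg c
  simp only [innovVar]
  linarith

theorem innovVar_ne_zero (hS : S.PosSemidef) : innovVar c S ≠ 0 :=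
  (zero_lt_one.trans_le (one_le_innovVar hS)).ne'

theorem mulVec_eq_smul_gain (h : innovVar c S ≠ 0) :
    M *ᵥ (S *ᵥ c) = innovVar c S • gain M c S := by
  rw [gain, smul_smul, mul_inv_cancel₀ h, one_smul]

theorem riccatiMap_eq (hS : S.IsSymm) (h : innovVar c S ≠ 0) :
    riccatiMap M c S = M * S * Mᵀ - innovVar c S • vecMulVec (gain M c S) (gain M c S) := by
  rw [riccatiMap, Matrix.vecMul_transpose, ← Matrix.mulVec_transpose, hS.eq,
    mulVec_eq_smul_gain h, Matrix.smul_vecMulVec, Matrix.vecMulVec_smul, smul_smul, smul_smul,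
    inv_mul_cancel₀ h, one_mul, Matrix.mul_assoc]

theorem closedLoop_transpose {κ : Type*} {M : Matrix κ κ ℝ} {c : κ → ℝ} (L : κ → ℝ) : (closedLoop M c L)ᵀ = Mᵀ - vecMulVec c L := by
  rw [closedLoop, Matrix.transpose_sub, Matrix.transpose_vecMulVec]

/-- Completion of squares in the Riccati map. -/
theorem closedLoop_mul_mul_transpose (hS : S.IsSymm) (h : innovVar c S ≠ 0) (L : ι → ℝ) :
    closedLoop M c L * S * (closedLoop M c L)ᵀ + vecMulVec L L =
      riccatiMap M c S +
        innovVar c S • vecMulVec (L - gain M c S) (L - gain M c S) := by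
  rw [riccatiMap_eq hS h, closedLoop_transpose, closedLoop]
  have h1 : c ᵥ* S = S *ᵥ c := by rw [← Matrix.mulVec_transpose, hS.eq]
  have h2 : (S *ᵥ c) ᵥ* Mᵀ = innovVar c S • gain M c S := by
    rw [Matrix.vecMul_transpose, mulVec_eq_smul_gain h]
  have h3 : (S *ᵥ c) ⬝ᵥ c = innovVar c S - 1 := by rw [innovVar, dotProduct_comm]; ring
  rw [Matrix.sub_mul, Matrix.sub_mul, Matrix.mul_sub, Matrix.mul_sub, Matrix.vecMulVec_mul, h1,
    Matrix.vecMulVec_mul, h2, Matrix.mul_vecMulVec, ← Matrix.mulVec_mulVec, mulVec_eq_smul_gain h,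
    Matrix.vecMulVec_mul_vecMulVec, h3]
  ext i j
  simp only [Matrix.add_apply, Matrix.sub_apply, Matrix.smul_apply, Matrix.vecMulVec_apply,
    Pi.smul_apply, Pi.sub_apply, smul_eq_mul]
  ring

theorem riccatiMap_eq_closedLoop (hS : S.IsSymm) (h : innovVar c S ≠ 0) :
    riccatiMap M c S = closedLoop M c (gain M c S) * S * (closedLoop M c (gain M c S))ᵀ +
      vecMulVec (gain M c S) (gain M c S) := by
  rw [closedLoop_mul_mul_transpose hS h, sub_self, Matrix.zero_vecMulVec, smul_zero, add_zero]

theorem riccatiMap_posSemidef (hS : S.PosSemidef) : (riccatiMap M c S).PosSemidef := by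
  rw [riccatiMap_eq_closedLoop hS.isSymm (innovVar_ne_zero hS)]
  exact (posSemidef_conj hS _).add (posSemidef_vecMulVec _)

theorem riccatiMap_le (hS : S.PosSemidef) (L : ι → ℝ) :
    (closedLoop M c L * S * (closedLoop M c L)ᵀ + vecMulVec L L - riccatiMap M c S).PosSemidef := by
  rw [closedLoop_mul_mul_transpose hS.isSymm (innovVar_ne_zero hS), add_sub_cancel_left]
  exact (posSemidef_vecMulVec _).smul (zero_le_one.trans (one_le_innovVar hS))

/-- The gain of `S'` is suboptimal for `S`, and for a fixed gain the affine map is monotone. -/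
theorem riccatiMap_mono {S' : Matrix ι ι ℝ} (hS : S.PosSemidef) (hS' : S'.PosSemidef)
    (h : (S' - S).PosSemidef) : (riccatiMap M c S' - riccatiMap M c S).PosSemidef := by
  have h1 := riccatiMap_le (M := M) (c := c) hS (gain M c S')
  have h2 := posSemidef_conj h (closedLoop M c (gain M c S'))
  convert h1.add h2 using 1
  rw [riccatiMap_eq_closedLoop hS'.isSymm (innovVar_ne_zero hS'), Matrix.mul_sub, Matrix.sub_mul]
  abel

theorem riccatiMap_eq_closedLoop_mul :
    riccatiMap M c S = closedLoop M c (gain M c S) * S * Mᵀ := by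
  rw [riccatiMap, closedLoop, Matrix.sub_mul, Matrix.sub_mul, Matrix.vecMulVec_mul,
    Matrix.vecMulVec_mul, gain, Matrix.smul_vecMulVec]

theorem riccatiMap_eq_mul_closedLoop (hS : S.IsSymm) :
    riccatiMap M c S = M * S * (closedLoop M c (gain M c S))ᵀ := by
  rw [riccatiMap, closedLoop_transpose, Matrix.mul_sub, gain, Matrix.vecMulVec_smul,
    Matrix.mul_smul, Matrix.mul_vecMulVec, Matrix.vecMul_transpose, ← Matrix.mulVec_transpose,
    hS.eq, ← Matrix.mulVec_mulVec]

theorem closedLoop_mul_mulVec (h : innovVar c S ≠ 0) :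
    closedLoop M c (gain M c S) *ᵥ (S *ᵥ c) = gain M c S := by
  rw [closedLoop, Matrix.sub_mulVec, Matrix.vecMulVec_mulVec, mulVec_eq_smul_gain h, innovVar]
  ext i
  simp
  ring

/-- Write one image as `Y(S) S Mᵀ` and the other as `M S' Y(S')ᵀ`. Replacing the outer `M` by a
closed loop subtracts the same rank-one matrix from both, so it cancels. -/
theorem riccatiMap_sub {S' : Matrix ι ι ℝ} (hS' : S'.IsSymm)
    (h : innovVar c S ≠ 0) (h' : innovVar c S' ≠ 0) :
    riccatiMap M c S - riccatiMap M c S' =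
      closedLoop M c (gain M c S) * (S - S') * (closedLoop M c (gain M c S'))ᵀ := by
  rw [riccatiMap_eq_closedLoop_mul, riccatiMap_eq_mul_closedLoop hS']
  have h1 := closedLoop_mul_mulVec (M := M) h
  have h2 := closedLoop_mul_mulVec (M := M) h'
  have h3 : c ᵥ* (S' * (closedLoop M c (gain M c S'))ᵀ) = gain M c S' := by
    rw [← Matrix.vecMul_vecMul, Matrix.vecMul_transpose, ← Matrix.mulVec_transpose, hS'.eq, h2]
  have e1 : closedLoop M c (gain M c S) * S * (closedLoop M c (gain M c S'))ᵀ =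
      closedLoop M c (gain M c S) * S * Mᵀ - vecMulVec (gain M c S) (gain M c S') := by
    conv_lhs => rw [closedLoop_transpose, Matrix.mul_sub, Matrix.mul_vecMulVec,
      ← Matrix.mulVec_mulVec, h1]
  have e2 : closedLoop M c (gain M c S) * S' * (closedLoop M c (gain M c S'))ᵀ =
      M * S' * (closedLoop M c (gain M c S'))ᵀ - vecMulVec (gain M c S) (gain M c S') := by
    rw [Matrix.mul_assoc]
    conv_lhs => rw [closedLoop, Matrix.sub_mul, Matrix.vecMulVec_mul, h3]
    rw [Matrix.mul_assoc]
  rw [Matrix.mul_sub, Matrix.sub_mul, e1, e2]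
  abel

theorem continuous_innovVar : Continuous (innovVar c) := by
  unfold innovVar
  fun_prop

theorem continuousAt_gain (h : innovVar c S ≠ 0) : ContinuousAt (gain M c) S := by
  unfold gain
  exact (continuous_innovVar.continuousAt.inv₀ h).smul (by fun_prop)

theorem continuous_closedLoop {κ : Type*} {M : Matrix κ κ ℝ} {c : κ → ℝ} : Continuous (closedLoop M c) := by
  unfold closedLoop
  fun_prop

theorem continuousAt_closedLoop_gain (h : innovVar c S ≠ 0) :
    ContinuousAt (fun S => closedLoop M c (gain M c S)) S :=
  continuous_closedLoop.continuousAt.comp (continuousAt_gain h)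

theorem continuousAt_riccatiMap (h : innovVar c S ≠ 0) : ContinuousAt (riccatiMap M c) S := by
  have : riccatiMap M c = fun S => closedLoop M c (gain M c S) * S * Mᵀ :=
    funext fun S => riccatiMap_eq_closedLoop_mul
  rw [this]
  exact ((continuousAt_closedLoop_gain h).mul continuousAt_id).mul continuousAt_const

end RiccatiAlgebra

/-! ### Existence and uniqueness of the stabilizing solution -/

section Existence

variable [DecidableEq ι] {M : Matrix ι ι ℝ} {c : ι → ℝ}

/-- The Riccati iteration with process noise `ε`, started from zero. -/
def regularizedSeq (M : Matrix ι ι ℝ) (c : ι → ℝ) (ε : ℝ) : ℕ → Matrix ι ι ℝ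
  | 0 => 0
  | k + 1 => riccatiMap M c (regularizedSeq M c ε k) + ε • 1

theorem regularizedSeq_posSemidef {ε : ℝ} (hε : 0 ≤ ε) (k : ℕ) :
    (regularizedSeq M c ε k).PosSemidef := by
  induction k with
  | zero => exact Matrix.PosSemidef.zero
  | succ k ih => exact (riccatiMap_posSemidef ih).add (Matrix.PosSemidef.one.smul hε)

theorem regularizedSeq_mono {ε : ℝ} (hε : 0 ≤ ε) (k : ℕ) :
    (regularizedSeq M c ε (k + 1) - regularizedSeq M c ε k).PosSemidef := by
  induction k with
  | zero => simpa [regularizedSeq] using regularizedSeq_posSemidef (M := M) (c := c) hε 1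
  | succ k ih =>
    have := riccatiMap_mono (M := M) (c := c) (regularizedSeq_posSemidef hε k)
      (regularizedSeq_posSemidef hε (k + 1)) ih
    rwa [regularizedSeq, regularizedSeq.eq_2 _ _ _ k, add_sub_add_right_eq_sub]

/-- `P` dominates the regularized Riccati image of anything below it, for all `ε ≤ 1` at once; this
uniformity gives the compactness used as `ε → 0`. -/
theorem regularizedSeq_le {ε : ℝ} (hε : 0 ≤ ε) (hε1 : ε ≤ 1) {L : ι → ℝ} {P : Matrix ι ι ℝ}
    (hP : P.PosSemidef)
    (hPe : P = closedLoop M c L * P * (closedLoop M c L)ᵀ + (vecMulVec L L + 1)) (k : ℕ) :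
    (P - regularizedSeq M c ε k).PosSemidef := by
  induction k with
  | zero => simpa [regularizedSeq] using hP
  | succ k ih =>
    have h1 := riccatiMap_le (M := M) (c := c)
      (regularizedSeq_posSemidef (M := M) (c := c) hε k) L
    have h2 := posSemidef_conj ih (closedLoop M c L)
    have h3 : ((1 - ε) • (1 : Matrix ι ι ℝ)).PosSemidef :=
      Matrix.PosSemidef.one.smul (sub_nonneg.2 hε1)
    convert (h1.add h2).add h3 using 1
    conv_lhs => rw [hPe]
    rw [regularizedSeq, Matrix.mul_sub, Matrix.sub_mul, sub_smul, one_smul]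
    abel

/-- Quadratic forms converge by monotonicity and boundedness; polarization recovers the entries. -/
theorem exists_tendsto_of_mono {T : ℕ → Matrix ι ι ℝ} {P : Matrix ι ι ℝ}
    (hsymm : ∀ k, (T k).IsSymm) (hmono : ∀ k, (T (k + 1) - T k).PosSemidef)
    (hP : ∀ k, (P - T k).PosSemidef) : ∃ S, Tendsto T atTop (𝓝 S) := by
  have hq : ∀ w : ι → ℝ, ∃ a, Tendsto (fun k => w ⬝ᵥ (T k *ᵥ w)) atTop (𝓝 a) := by
    intro w
    refine ⟨_, tendsto_atTop_ciSup (monotone_nat_of_le_succ fun k => ?_)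
      ⟨w ⬝ᵥ (P *ᵥ w), ?_⟩⟩
    · have := (hmono k).quad_nonneg w
      rw [Matrix.sub_mulVec, dotProduct_sub] at this
      linarith
    · rintro _ ⟨k, rfl⟩
      have := (hP k).quad_nonneg w
      rw [Matrix.sub_mulVec, dotProduct_sub] at this
      simp only
      linarith
  choose a ha using hq
  refine ⟨Matrix.of fun i j => (a (Pi.single i 1 + Pi.single j 1) - a (Pi.single i 1) -
    a (Pi.single j 1)) / 2, tendsto_pi_nhds.2 fun i => tendsto_pi_nhds.2 fun j => ?_⟩
  refine (((ha (Pi.single i 1 + Pi.single j 1)).sub (ha (Pi.single i 1))).sub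
    (ha (Pi.single j 1)) |>.div_const 2).congr fun k => ?_
  have := (hsymm k).apply i j
  simp [Matrix.mulVec_add]
  linarith

theorem exists_regularized {ε : ℝ} (hε : 0 < ε) (hε1 : ε ≤ 1) {L : ι → ℝ} {P : Matrix ι ι ℝ}
    (hP : P.PosSemidef)
    (hPe : P = closedLoop M c L * P * (closedLoop M c L)ᵀ + (vecMulVec L L + 1)) :
    ∃ S : Matrix ι ι ℝ, S.PosSemidef ∧ (P - S).PosSemidef ∧ S = riccatiMap M c S + ε • 1 := by
  have hpos := regularizedSeq_posSemidef (M := M) (c := c) hε.le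
  have hle := regularizedSeq_le hε.le hε1 hP hPe
  obtain ⟨S, hS⟩ := exists_tendsto_of_mono (fun k => (hpos k).isSymm)
    (regularizedSeq_mono hε.le) hle
  have hSp : S.PosSemidef := isClosed_posSemidef.mem_of_tendsto hS (Eventually.of_forall hpos)
  refine ⟨S, hSp, isClosed_posSemidef.mem_of_tendsto (hS.const_sub P) (Eventually.of_forall hle), ?_⟩
  refine tendsto_nhds_unique (hS.comp (tendsto_add_atTop_nat 1)) ?_
  exact ((continuousAt_riccatiMap (innovVar_ne_zero hSp)).tendsto.comp hS).add_const _

theorem exists_isStabilizingSolution {L : ι → ℝ} (hL : IsSchurStable (closedLoop M c L))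
    (hM : ∀ z ∈ eigs M, ‖z‖ ≠ 1) :
    ∃ S : Matrix ι ι ℝ, S.PosSemidef ∧ IsStabilizingSolution M c S := by
  obtain ⟨P, hP, hPe⟩ := exists_lyapunov hL ((posSemidef_vecMulVec L).add Matrix.PosSemidef.one)
  have hex : ∀ k : ℕ, ∃ S : Matrix ι ι ℝ, S.PosSemidef ∧ (P - S).PosSemidef ∧
      S = riccatiMap M c S + (1 / ((k : ℝ) + 1)) • 1 := fun k =>
    exists_regularized (by positivity) (by
      rw [div_le_one (by positivity)]; linarith [(Nat.cast_nonneg k : (0 : ℝ) ≤ k)]) hP hPe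
  choose T hT hTP hTe using hex
  have hcpt : IsCompact (Set.univ.pi fun i : ι => Set.univ.pi fun j : ι =>
      Set.Icc (-(P i i + P j j)) (P i i + P j j)) :=
    isCompact_univ_pi fun i => isCompact_univ_pi fun j => isCompact_Icc
  obtain ⟨S, -, φ, hφ, hS⟩ := hcpt.tendsto_subseq (x := fun k i j => T k i j) fun k i _ j _ =>
    abs_le.1 (abs_entry_le (hT k) (hTP k) i j)
  change Tendsto (T ∘ φ) atTop (𝓝 (S : Matrix ι ι ℝ)) at hS
  have hSp : Matrix.PosSemidef S :=
    isClosed_posSemidef.mem_of_tendsto hS (Eventually.of_forall fun k => hT _)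
  have hne := innovVar_ne_zero (c := c) hSp
  have hSe : S = riccatiMap M c S := by
    refine tendsto_nhds_unique hS ?_
    have h1 : Tendsto (fun k => (1 / ((φ k : ℝ) + 1)) • (1 : Matrix ι ι ℝ)) atTop (𝓝 0) := by
      have := ((tendsto_one_div_add_atTop_nhds_zero_nat (𝕜 := ℝ)).comp
        hφ.tendsto_atTop).smul_const (1 : Matrix ι ι ℝ)
      simpa using this
    have h2 := ((continuousAt_riccatiMap (M := M) hne).tendsto.comp hS).add h1
    rw [add_zero] at h2
    exact h2.congr fun k => (hTe (φ k)).symm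
  refine ⟨S, hSp, hSp.isSymm, hne, hSe, fun z hz => ?_⟩
  have hle : ‖z‖ ≤ 1 := by
    refine norm_le_one_of_tendsto ((continuousAt_closedLoop_gain (M := M) hne).tendsto.comp hS)
      (fun k => ?_) hz
    refine isSchurStable_of_lyapunov (S := T (φ k)) (l := gain M c (T (φ k)))
      (ε := 1 / ((φ k : ℝ) + 1)) (by positivity) (hT _) ?_
    conv_lhs => rw [hTe (φ k), riccatiMap_eq_closedLoop (hT _).isSymm (innovVar_ne_zero (hT _))]
    rfl
  -- On the unit circle the Lyapunov identity with `ε = 0` forces the gain to annihilate both parts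
  -- of the eigenvector, so `Yᵀ` and `Mᵀ` agree there.
  refine lt_of_le_of_ne hle fun h1 => ?_
  rw [← eigs_transpose, mem_eigs_iff_real] at hz
  obtain ⟨x, y, h0, hx, hy⟩ := hz
  have h2 := lyapunov_eigenvector (S := S) (ε := 0) (l := gain M c S) (by
    rw [zero_smul, add_zero, ← riccatiMap_eq_closedLoop hSp.isSymm hne]; exact hSe) hx hy
  rw [h1] at h2
  have h3 : gain M c S ⬝ᵥ x = 0 := by nlinarith
  have h4 : gain M c S ⬝ᵥ y = 0 := by nlinarith
  have h5 : ∀ w, gain M c S ⬝ᵥ w = 0 → (closedLoop M c (gain M c S))ᵀ *ᵥ w = Mᵀ *ᵥ w := by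
    intro w hw
    rw [closedLoop_transpose, Matrix.sub_mulVec, Matrix.vecMulVec_mulVec, hw]
    simp
  refine hM z ?_ h1
  rw [← eigs_transpose, mem_eigs_iff_real]
  exact ⟨x, y, h0, by rw [← h5 x h3, hx], by rw [← h5 y h4, hy]⟩

/-- Iterating `riccatiMap_sub` puts decaying powers on both sides of `S - S'`. -/
theorem IsStabilizingSolution.unique {S S' : Matrix ι ι ℝ} (h : IsStabilizingSolution M c S)
    (h' : IsStabilizingSolution M c S') : S = S' := by
  have h1 : ∀ t : ℕ, S - S' = closedLoop M c (gain M c S) ^ t * (S - S') *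
      ((closedLoop M c (gain M c S')) ^ t)ᵀ := by
    intro t
    induction t with
    | zero => simp
    | succ t ih =>
      conv_lhs => rw [h.eq, h'.eq, riccatiMap_sub h'.symm h.denom h'.denom, ih]
      simp only [pow_succ', Matrix.transpose_mul, Matrix.mul_assoc]
  have h2 : Tendsto (fun t : ℕ => closedLoop M c (gain M c S) ^ t * (S - S') *
      ((closedLoop M c (gain M c S')) ^ t)ᵀ) atTop (𝓝 (0 * (S - S') * 0ᵀ)) := by
    have ht : Tendsto (fun t : ℕ => ((closedLoop M c (gain M c S')) ^ t)ᵀ) atTop (𝓝 0ᵀ) :=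
      (continuous_id.matrix_transpose.tendsto 0).comp h'.stable.tendsto_pow
    exact (h.stable.tendsto_pow.mul_const (S - S')).mul ht
  rw [Matrix.zero_mul, Matrix.zero_mul] at h2
  exact sub_eq_zero.1 (tendsto_nhds_unique (tendsto_const_nhds.congr h1) h2)

end Existence

end


/-! ### Convergence of the Riccati recursion, given bounded transition matrices -/

section Convergence

variable {ι : Type*} [Fintype ι] {M : Matrix ι ι ℝ} {c : ι → ℝ} {S₀ : Matrix ι ι ℝ}

theorem riccatiSeq_posSemidef (hS₀ : S₀.PosSemidef) (t : ℕ) : (riccatiSeq M c S₀ t).PosSemidef := by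
  induction t with
  | zero => exact hS₀
  | succ t ih => exact riccatiMap_posSemidef ih

/-- A stable observer gain bounds the Riccati recursion. -/
theorem exists_riccatiSeq_le [DecidableEq ι] (hS₀ : S₀.PosSemidef) {L : ι → ℝ}
    (hL : IsSchurStable (closedLoop M c L)) :
    ∃ P : Matrix ι ι ℝ, ∀ t, (P - riccatiSeq M c S₀ t).PosSemidef := by
  -- The source term `S₀` makes `P` dominate the initial value as well.
  obtain ⟨P, hP, hPe⟩ := exists_lyapunov hL ((posSemidef_vecMulVec L).add hS₀)
  refine ⟨P, fun t => ?_⟩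
  induction t with
  | zero =>
    convert (posSemidef_conj hP (closedLoop M c L)).add (posSemidef_vecMulVec L) using 1
    conv_lhs => rw [hPe]
    rw [riccatiSeq]
    abel
  | succ t ih =>
    have h1 := riccatiMap_le (M := M) (c := c) (riccatiSeq_posSemidef (M := M) (c := c) hS₀ t) L
    have h2 := posSemidef_conj ih (closedLoop M c L)
    convert (h1.add h2).add hS₀ using 1
    conv_lhs => rw [hPe]
    rw [riccatiSeq, Matrix.mul_sub, Matrix.sub_mul]
    abel

/-- Cauchy–Schwarz with one coordinate appended; the cross term is handled by the
arithmetic-geometric mean inequality. -/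
theorem sq_add_mul_le {X a α β η : ℝ} (hα : 0 ≤ α) (hη : 0 ≤ η) (h : X ^ 2 ≤ α * η) :
    (X + a * β) ^ 2 ≤ (α + β ^ 2) * (η + a ^ 2) := by
  have h1 : |2 * X * a * β| ≤ α * a ^ 2 + β ^ 2 * η := by
    refine abs_le_of_sq_le_sq ?_ (by positivity)
    have h2 := mul_le_mul_of_nonneg_right h (by positivity : 0 ≤ 4 * (a ^ 2 * β ^ 2))
    nlinarith [sq_nonneg (α * a ^ 2 - β ^ 2 * η)]
  have h2 := (abs_le.1 h1).2
  nlinarith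

/-- A response of the closed loop to the inputs `a`, fed in along the gains, is controlled by the
Riccati covariance. -/
theorem sq_dotProduct_le (hS₀ : S₀.PosSemidef) {d : ℕ → ι → ℝ} {a : ℕ → ℝ} {η : ℝ} (hη : 0 ≤ η)
    (h0 : ∀ w : ι → ℝ, (w ⬝ᵥ d 0) ^ 2 ≤ (w ⬝ᵥ (S₀ *ᵥ w)) * η)
    (hd : ∀ t, d (t + 1) = closedLoop M c (gain M c (riccatiSeq M c S₀ t)) *ᵥ d t +
      a t • gain M c (riccatiSeq M c S₀ t)) (t : ℕ) (w : ι → ℝ) :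
    (w ⬝ᵥ d t) ^ 2 ≤ (w ⬝ᵥ (riccatiSeq M c S₀ t *ᵥ w)) * (η + ∑ s ∈ Finset.range t, a s ^ 2) := by
  induction t generalizing w with
  | zero => simpa [riccatiSeq] using h0 w
  | succ t ih =>
    have hp := riccatiSeq_posSemidef (M := M) (c := c) hS₀ t
    rw [hd, riccatiSeq, riccatiMap_eq_closedLoop hp.isSymm (innovVar_ne_zero hp),
      Finset.sum_range_succ, Matrix.add_mulVec, dotProduct_add, dotProduct_add,
      dotProduct_conj_mulVec, dotProduct_vecMulVec_mulVec, dotProduct_smul, smul_eq_mul,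
      Matrix.dotProduct_mulVec, ← Matrix.mulVec_transpose, ← add_assoc, ← sq,
      dotProduct_comm w (gain M c _)]
    -- With `Y`, `l` the closed loop and gain at time `t`, the old quadratic form is taken at `Yᵀ
    -- w`, and the appended coordinates are `l ⬝ᵥ w` and `a t`.
    exact sq_add_mul_le (hp.quad_nonneg _)
      (add_nonneg hη (Finset.sum_nonneg fun s _ => sq_nonneg _)) (ih _)

/-- The transition matrix of the time-varying closed loop. -/
def closedProd [DecidableEq ι] (M : Matrix ι ι ℝ) (c : ι → ℝ) (S₀ : Matrix ι ι ℝ) : ℕ → Matrix ι ι ℝ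
  | 0 => 1
  | t + 1 => closedLoop M c (gain M c (riccatiSeq M c S₀ t)) * closedProd M c S₀ t

theorem riccatiSeq_sub [DecidableEq ι] (hS₀ : S₀.PosSemidef) {S : Matrix ι ι ℝ}
    (hS : IsStabilizingSolution M c S) (t : ℕ) :
    riccatiSeq M c S₀ t - S =
      closedProd M c S₀ t * (S₀ - S) * (closedLoop M c (gain M c S) ^ t)ᵀ := by
  induction t with
  | zero => simp [closedProd, riccatiSeq]
  | succ t ih =>
    have hp := riccatiSeq_posSemidef (M := M) (c := c) hS₀ t
    conv_lhs => rw [hS.eq, riccatiSeq, riccatiMap_sub hS.symm (innovVar_ne_zero hp) hS.denom, ih]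
    simp only [closedProd, pow_succ', Matrix.transpose_mul, Matrix.mul_assoc]

theorem tendsto_riccatiSeq [DecidableEq ι] (hS₀ : S₀.PosSemidef) {S : Matrix ι ι ℝ}
    (hS : IsStabilizingSolution M c S)
    (hb : ∀ i j, ∃ B, ∀ t, |closedProd M c S₀ t i j| ≤ B) :
    Tendsto (riccatiSeq M c S₀) atTop (𝓝 S) := by
  rw [← tendsto_sub_nhds_zero_iff]
  simp_rw [riccatiSeq_sub hS₀ hS]
  refine tendsto_pi_nhds.2 fun i => tendsto_pi_nhds.2 fun j => ?_
  simp only [Matrix.mul_apply, Matrix.transpose_apply, Finset.sum_mul]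
  rw [show (0 : Matrix ι ι ℝ) i j = ∑ a : ι, ∑ b : ι, (0 : ℝ) by simp]
  refine tendsto_finsetSum _ fun a _ => tendsto_finsetSum _ fun b _ => ?_
  obtain ⟨B, hB⟩ := hb i b
  have h1 : Tendsto (fun t : ℕ => (closedLoop M c (gain M c S) ^ t) j a) atTop (𝓝 0) :=
    tendsto_pi_nhds.1 (tendsto_pi_nhds.1 hS.stable.tendsto_pow j) a
  have h2 : Tendsto (fun t : ℕ => B * |(S₀ - S) b a| * |(closedLoop M c (gain M c S) ^ t) j a|)
      atTop (𝓝 0) := by simpa using h1.abs.const_mul (B * |(S₀ - S) b a|)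
  refine squeeze_zero_norm (fun t => ?_) h2
  rw [Real.norm_eq_abs, abs_mul, abs_mul]
  gcongr
  exact hB t

end Convergence

/-! ### Deadbeat observer gain -/

section Deadbeat

/-- An observable pair admits a deadbeat observer gain. -/
theorem IsObservable.exists_deadbeat {n : ℕ} {A : Matrix (Fin (n + 1)) (Fin (n + 1)) ℝ}
    {C : Fin (n + 1) → ℝ} (h : IsObservable A C) :
    ∃ L : Fin (n + 1) → ℝ, (A - vecMulVec L C) ^ (n + 1) = 0 := by
  set O : Matrix (Fin (n + 1)) (Fin (n + 1)) ℝ := Matrix.of fun i j => (C ᵥ* A ^ (i : ℕ)) j with hO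
  have hOu : IsUnit O.det := (Matrix.isUnit_iff_isUnit_det _).1 h
  -- As in Ackermann's formula, `q` is chosen so that `C A ^ i q` vanishes for `i < n` and equals
  -- `1` for `i = n`.
  set q := O⁻¹ *ᵥ Pi.single (Fin.last n) 1 with hq
  have hOq : O *ᵥ q = Pi.single (Fin.last n) 1 := by
    rw [hq, Matrix.mulVec_mulVec, Matrix.mul_nonsing_inv _ hOu, Matrix.one_mulVec]
  have hC : ∀ i : ℕ, i ≤ n → C ⬝ᵥ (A ^ i *ᵥ q) = if i = n then 1 else 0 := by
    intro i hi
    have h1 := congrFun hOq ⟨i, Nat.lt_succ_of_le hi⟩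
    rw [Matrix.dotProduct_mulVec]
    refine (show _ = (O *ᵥ q) ⟨i, Nat.lt_succ_of_le hi⟩ from rfl).trans (h1.trans ?_)
    simp [Pi.single_apply, Fin.ext_iff]
  -- `N` shifts along `q, A q, …, A ^ n q` like `A`, but the gain makes it send the last vector to
  -- zero.
  set N := A - vecMulVec (A ^ (n + 1) *ᵥ q) C with hN
  have hNA : ∀ i : ℕ, i < n → N *ᵥ (A ^ i *ᵥ q) = A ^ (i + 1) *ᵥ q := by
    intro i hi
    rw [hN, Matrix.sub_mulVec, Matrix.vecMulVec_mulVec, hC i hi.le, if_neg hi.ne,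
      Matrix.mulVec_mulVec, ← pow_succ']
    simp
  have hNn : N *ᵥ (A ^ n *ᵥ q) = 0 := by
    rw [hN, Matrix.sub_mulVec, Matrix.vecMulVec_mulVec, hC n le_rfl, if_pos rfl,
      Matrix.mulVec_mulVec, ← pow_succ']
    simp
  have hpow : ∀ i : ℕ, i ≤ n → N ^ i *ᵥ q = A ^ i *ᵥ q := by
    intro i
    induction i with
    | zero => simp
    | succ i ih =>
      intro hi
      rw [pow_succ', ← Matrix.mulVec_mulVec, ih (by omega), hNA i (by omega)]
  have hzero : N ^ (n + 1) *ᵥ q = 0 := by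
    rw [pow_succ', ← Matrix.mulVec_mulVec, hpow n le_rfl, hNn]
  refine ⟨A ^ (n + 1) *ᵥ q, ?_⟩
  -- In reversed order, these vectors make `O * Q` lower triangular with unit diagonal; hence they
  -- form a basis.
  set Q : Matrix (Fin (n + 1)) (Fin (n + 1)) ℝ := Matrix.of fun i j => (A ^ (n - (j : ℕ)) *ᵥ q) i
    with hQ
  have hOQ : ∀ i j : Fin (n + 1), (O * Q) i j = C ⬝ᵥ (A ^ ((i : ℕ) + (n - (j : ℕ))) *ᵥ q) := by
    intro i j
    rw [pow_add, ← Matrix.mulVec_mulVec, Matrix.dotProduct_mulVec]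
    rfl
  have hdet : (O * Q).det = 1 := by
    rw [Matrix.det_of_isLowerTriangular]
    · refine Finset.prod_eq_one fun i _ => ?_
      rw [hOQ, hC _ (by omega), if_pos (by omega)]
    · intro i j hij
      have hij' : (i : ℕ) < j := hij
      rw [hOQ, hC _ (by omega), if_neg (by omega)]
  have hQu : IsUnit Q.det := by
    rw [Matrix.det_mul] at hdet
    exact IsUnit.of_mul_eq_one_right _ hdet
  have hNQ : N ^ (n + 1) * Q = 0 := by
    ext i j
    have h1 : (N ^ (n + 1) * Q) i j = (N ^ (n + 1) *ᵥ (A ^ (n - (j : ℕ)) *ᵥ q)) i := rfl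
    rw [h1, ← hpow _ (Nat.sub_le _ _), Matrix.mulVec_mulVec, ← pow_add,
      add_comm (n + 1) (n - (j : ℕ)), pow_add,
      ← Matrix.mulVec_mulVec, hzero, Matrix.mulVec_zero]
    rfl
  have h2 := congrArg (· * Q⁻¹) hNQ
  simpa [Matrix.mul_assoc, Matrix.mul_nonsing_inv _ hQu] using h2

end Deadbeat

/-! ### Antistable matrices and the Sylvester equation -/

section Antistable

variable {ι : Type*} [Fintype ι] [DecidableEq ι]

theorem isUnit_det_of_zero_notMem_eigs {A : Matrix ι ι ℝ} (h : (0 : ℂ) ∉ eigs A) :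
    IsUnit A.det := by
  rw [isUnit_iff_ne_zero]
  intro h0
  refine h (spectrum.zero_mem ℂ ?_)
  rw [Matrix.isUnit_iff_isUnit_det, isUnit_iff_ne_zero, not_not]
  have := (RingHom.map_det Complex.ofRealHom A).symm
  rw [h0, map_zero] at this
  exact this

/-- `A⁻¹` is Schur stable, so `w = A⁻¹ ^ t (A ^ t w)` tends to zero. -/
theorem eq_zero_of_tendsto_pow_mulVec {A : Matrix ι ι ℝ} (hA : ∀ z ∈ eigs A, 1 < ‖z‖) {w : ι → ℝ}
    (hw : Tendsto (fun t => A ^ t *ᵥ w) atTop (𝓝 0)) : w = 0 := by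
  have hu : IsUnit A.det := isUnit_det_of_zero_notMem_eigs fun h => by
    have := hA 0 h
    norm_num at this
  have hmap : A.map Complex.ofReal * A⁻¹.map Complex.ofReal = 1 := by
    have h1 : A.map Complex.ofRealHom * A⁻¹.map Complex.ofRealHom =
      (A * A⁻¹).map Complex.ofRealHom := Matrix.map_mul.symm
    rw [Matrix.mul_nonsing_inv _ hu, Matrix.map_one _ (map_zero _) (map_one _)] at h1
    exact h1
  have hinv : IsSchurStable A⁻¹ := by
    intro z hz
    obtain ⟨v, hv, hz⟩ := mem_eigs_iff_exists.1 hz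
    have h1 : v = z • (A.map Complex.ofReal *ᵥ v) := by
      rw [← Matrix.mulVec_smul, ← hz, Matrix.mulVec_mulVec, hmap, Matrix.one_mulVec]
    have hz0 : z ≠ 0 := by
      rintro rfl
      exact hv (by simpa using h1)
    have h2 : A.map Complex.ofReal *ᵥ v = z⁻¹ • v := by
      conv_rhs => rw [h1]
      rw [smul_smul, inv_mul_cancel₀ hz0, one_smul]
    have h3 := hA _ (mem_eigs_iff_exists.2 ⟨v, hv, h2⟩)
    rw [norm_inv] at h3
    exact (one_lt_inv₀ (norm_pos_iff.2 hz0)).1 h3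
  have h1 : ∀ t : ℕ, (A⁻¹) ^ t *ᵥ (A ^ t *ᵥ w) = w := fun t => by
    rw [Matrix.mulVec_mulVec, Matrix.inv_pow', Matrix.nonsing_inv_mul _ (by
      rw [Matrix.det_pow]; exact hu.pow t), Matrix.one_mulVec]
  suffices h : Tendsto (fun t => (A⁻¹) ^ t *ᵥ (A ^ t *ᵥ w)) atTop (𝓝 0) by
    simp_rw [h1] at h
    exact tendsto_nhds_unique tendsto_const_nhds h
  refine tendsto_pi_nhds.2 fun i => ?_
  simp only [Matrix.mulVec, dotProduct]
  rw [show (0 : ι → ℝ) i = ∑ j : ι, (0 : ℝ) * 0 by simp]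
  refine tendsto_finsetSum _ fun j _ => ?_
  exact (tendsto_pi_nhds.1 (tendsto_pi_nhds.1 hinv.tendsto_pow i) j).mul (tendsto_pi_nhds.1 hw j)

/-- Solvability of the Sylvester equation `T A - F T = R`. -/
theorem exists_sylvester {κ : Type*} [Fintype κ] [DecidableEq κ] {A : Matrix ι ι ℝ}
    {F : Matrix κ κ ℝ} (hA : ∀ z ∈ eigs A, 1 < ‖z‖) (hF : IsSchurStable F) (R : Matrix κ ι ℝ) :
    ∃ T : Matrix κ ι ℝ, T * A = F * T + R := by
  let φ : Matrix κ ι ℝ →ₗ[ℝ] Matrix κ ι ℝ :=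
    { toFun := fun T => T * A - F * T
      map_add' := fun T U => by rw [Matrix.add_mul, Matrix.mul_add]; abel
      map_smul' := fun r T => by
        rw [Matrix.smul_mul, Matrix.mul_smul, smul_sub, RingHom.id_apply] }
  -- If `T A = F T` then `T A ^ t = F ^ t T → 0`; each row of `T` then decays under the antistable
  -- `Aᵀ` and vanishes. Finite dimension turns injectivity into surjectivity.
  have hinj : Function.Injective φ := by
    rw [← LinearMap.ker_eq_bot, LinearMap.ker_eq_bot']
    intro T hT
    have hT : T * A = F * T := sub_eq_zero.1 hT
    have hpow : ∀ t : ℕ, T * A ^ t = F ^ t * T := by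
      intro t
      induction t with
      | zero => simp
      | succ t ih => rw [pow_succ', ← Matrix.mul_assoc, hT, Matrix.mul_assoc, ih, ← Matrix.mul_assoc,
          ← pow_succ']
    ext i j
    refine congrFun (eq_zero_of_tendsto_pow_mulVec (A := Aᵀ) (w := T i)
      (by rwa [eigs_transpose]) ?_) j
    refine tendsto_pi_nhds.2 fun k => ?_
    have h1 : ∀ t : ℕ, (Aᵀ ^ t *ᵥ T i) k = ∑ l, (F ^ t) i l * T l k := by
      intro t
      rw [← Matrix.transpose_pow, Matrix.mulVec_transpose]
      exact (congrFun (congrFun (hpow t) i) k)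
    simp_rw [h1]
    rw [show (0 : ι → ℝ) k = ∑ l : κ, (0 : ℝ) * T l k by simp]
    exact tendsto_finsetSum _ fun l _ =>
      (tendsto_pi_nhds.1 (tendsto_pi_nhds.1 hF.tendsto_pow i) l).mul_const _
  obtain ⟨T, hT⟩ := (LinearMap.injective_iff_surjective.1 hinj) R
  exact ⟨T, by rw [← hT]; change _ = _ + (T * A - F * T); abel⟩

end Antistable

/-! ### The block system: stabilizing gain, bounded transitions, rank -/

section BlockSystem

variable {n m : ℕ} {A : Matrix (Fin (n + 1)) (Fin (n + 1)) ℝ} {C : Fin (n + 1) → ℝ}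
  {F : Matrix (Fin m) (Fin m) ℝ} {G H : Fin m → ℝ}

theorem sigmaZero_posSemidef : (sigmaZero n m).PosSemidef := by
  rw [posSemidef_iff_isSymm]
  refine ⟨?_, fun w => ?_⟩
  · simp [sigmaZero, Matrix.IsSymm, Matrix.fromBlocks_transpose]
  · obtain ⟨x, y, rfl⟩ : ∃ x y, w = Sum.elim x y := ⟨_, _, (Sum.elim_comp_inl_inr w).symm⟩
    simp only [sigmaZero, Matrix.fromBlocks_mulVec, Sum.elim_comp_inl, Sum.elim_comp_inr,
      Matrix.one_mulVec, Matrix.zero_mulVec, add_zero, sumElim_dotProduct_sumElim,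
      dotProduct_zero]
    exact Finset.sum_nonneg fun i _ => mul_self_nonneg (x i)

/-- The lower gain `G` cancels the coupling `G C`, so stability can be read off the diagonal blocks.
-/
theorem closedLoop_block (L : Fin (n + 1) → ℝ) :
    closedLoop (bigA A C F G) (bigC C H) (Sum.elim L G) =
      Matrix.fromBlocks (A - vecMulVec L C) (-vecMulVec L H) 0 (F - vecMulVec G H) := by
  ext (i | i) (j | j) <;> simp [closedLoop, bigA, bigC, Matrix.vecMulVec_apply]

theorem exists_stable_gain (hFGH : IsSchurStable (F - Matrix.vecMulVec G H))
    (hAC : IsObservable A C) :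
    ∃ L, IsSchurStable (closedLoop (bigA A C F G) (bigC C H) L) := by
  obtain ⟨L, hL⟩ := hAC.exists_deadbeat
  refine ⟨Sum.elim L G, ?_⟩
  rw [closedLoop_block]
  intro z hz
  rw [eigs_fromBlocks_zero₂₁] at hz
  exact hz.elim (isSchurStable_of_pow_eq_zero hL z) (hFGH z)

theorem eigs_bigA : eigs (bigA A C F G) = eigs A ∪ eigs F := eigs_fromBlocks_zero₁₂ _ _ _

theorem bigA_mulVec_inr (y : Fin m → ℝ) :
    bigA A C F G *ᵥ Sum.elim 0 y = Sum.elim (0 : Fin (n + 1) → ℝ) (F *ᵥ y) := by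
  simp [bigA, Matrix.fromBlocks_mulVec]

theorem IsSchurStable.exists_mulVec_bound {ι : Type*} [Fintype ι] [DecidableEq ι]
    {F : Matrix ι ι ℝ} (hF : IsSchurStable F) (y : ι → ℝ) :
    ∃ C ρ : ℝ, 0 ≤ C ∧ 0 < ρ ∧ ρ < 1 ∧ ∀ t i, |(F ^ t *ᵥ y) i| ≤ C * ρ ^ t := by
  obtain ⟨C, ρ, hC, h0, h1, hb⟩ := hF.exists_pow_bound
  refine ⟨C * ∑ j, |y j|, ρ, by positivity, h0, h1, fun t i => ?_⟩
  rw [Matrix.mulVec, dotProduct, Finset.mul_sum, Finset.sum_mul]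
  refine (Finset.abs_sum_le_sum_abs _ _).trans (Finset.sum_le_sum fun j _ => ?_)
  rw [abs_mul]
  calc |(F ^ t) i j| * |y j| ≤ C * ρ ^ t * |y j| := by gcongr; exact hb t i j
    _ = _ := by ring

theorem exists_closedProd_bound (hF : IsSchurStable F)
    (hFGH : IsSchurStable (F - Matrix.vecMulVec G H)) (hAC : IsObservable A C)
    (i j : Fin (n + 1) ⊕ Fin m) :
    ∃ B, ∀ t, |closedProd (bigA A C F G) (bigC C H) (sigmaZero n m) t i j| ≤ B := by
  set M := bigA A C F G with hM
  set c := bigC C H with hc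
  obtain ⟨L, hL⟩ := exists_stable_gain (n := n) (G := G) (H := H) hFGH hAC
  obtain ⟨P, hP⟩ := exists_riccatiSeq_le (sigmaZero_posSemidef (n := n) (m := m)) hL
  obtain ⟨x, y, hxy⟩ : ∃ x y, (Pi.single j 1 : Fin (n + 1) ⊕ Fin m → ℝ) = Sum.elim x y :=
    ⟨_, _, (Sum.elim_comp_inl_inr _).symm⟩
  obtain ⟨K, ρ, hK, h0, h1, hb⟩ := hF.exists_mulVec_bound y
  -- Open-loop trajectory from the part of `e_j` that `sigmaZero` does not see; it decays because
  -- `F` is stable.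
  set p : ℕ → Fin (n + 1) ⊕ Fin m → ℝ := fun t => Sum.elim 0 (F ^ t *ᵥ y) with hp
  have hps : ∀ t, p (t + 1) = M *ᵥ p t := fun t => by
    simp only [hp, hM, bigA_mulVec_inr, pow_succ', Matrix.mulVec_mulVec]
  have hpb : ∀ t a, |p t a| ≤ K * ρ ^ t := by
    rintro t (a | a)
    · simp only [hp, Sum.elim_inl, Pi.zero_apply, abs_zero]
      positivity
    · exact hb t a
  set K' := ∑ a, |c a| * K with hK'
  have hK'0 : 0 ≤ K' := by positivity
  have hcb : ∀ t, (c ⬝ᵥ p t) ^ 2 ≤ K' ^ 2 * (ρ ^ 2) ^ t := by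
    intro t
    have h2 : |c ⬝ᵥ p t| ≤ K' * ρ ^ t := by
      rw [dotProduct, hK', Finset.sum_mul]
      refine (Finset.abs_sum_le_sum_abs _ _).trans (Finset.sum_le_sum fun a _ => ?_)
      rw [abs_mul, mul_assoc]
      gcongr
      exact hpb t a
    calc (c ⬝ᵥ p t) ^ 2 ≤ (K' * ρ ^ t) ^ 2 := sq_le_sq.2 (h2.trans (le_abs_self _))
      _ = _ := by ring
  have hsum : ∀ t, ∑ s ∈ Finset.range t, (c ⬝ᵥ p s) ^ 2 ≤ K' ^ 2 * (1 - ρ ^ 2)⁻¹ := by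
    intro t
    have hρ : ρ ^ 2 < 1 := by nlinarith
    calc ∑ s ∈ Finset.range t, (c ⬝ᵥ p s) ^ 2 ≤ ∑ s ∈ Finset.range t, K' ^ 2 * (ρ ^ 2) ^ s :=
          Finset.sum_le_sum fun s _ => hcb s
      _ = K' ^ 2 * ∑ s ∈ Finset.range t, (ρ ^ 2) ^ s := by rw [Finset.mul_sum]
      _ ≤ _ := by
          gcongr
          rw [← tsum_geometric_of_lt_one (by positivity) hρ]
          exact (summable_geometric_of_lt_one (by positivity) hρ).sum_le_tsum _
            fun _ _ => by positivity
  -- Subtracting `p` leaves the initial value `(x, 0)`, in the range of `sigmaZero`, and inputs `-(c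
  -- ⬝ᵥ p t)` along the gains, which are square-summable. So `sq_dotProduct_le` applies.
  set d : ℕ → Fin (n + 1) ⊕ Fin m → ℝ :=
    fun t => closedProd M c (sigmaZero n m) t *ᵥ Pi.single j 1 - p t with hd
  have hds : ∀ t, d (t + 1) = closedLoop M c (gain M c (riccatiSeq M c (sigmaZero n m) t)) *ᵥ d t +
      (-(c ⬝ᵥ p t)) • gain M c (riccatiSeq M c (sigmaZero n m) t) := by
    intro t
    simp only [hd]
    rw [hps, closedProd, ← Matrix.mulVec_mulVec, Matrix.mulVec_sub]
    set q := closedProd M c (sigmaZero n m) t *ᵥ Pi.single j 1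
    set l := gain M c (riccatiSeq M c (sigmaZero n m) t)
    rw [show closedLoop M c l *ᵥ p t = M *ᵥ p t - (c ⬝ᵥ p t) • l by
      rw [closedLoop, Matrix.sub_mulVec, Matrix.vecMulVec_mulVec]; simp]
    module
  have hx0 : 0 ≤ x ⬝ᵥ x := Finset.sum_nonneg fun a _ => mul_self_nonneg (x a)
  have hd0 : ∀ w : Fin (n + 1) ⊕ Fin m → ℝ,
      (w ⬝ᵥ d 0) ^ 2 ≤ (w ⬝ᵥ (sigmaZero n m *ᵥ w)) * (x ⬝ᵥ x) := by
    intro w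
    obtain ⟨a, b, rfl⟩ : ∃ x y, w = Sum.elim x y := ⟨_, _, (Sum.elim_comp_inl_inr w).symm⟩
    have : d 0 = Sum.elim x 0 := by
      simp only [hd, hp, closedProd, Matrix.one_mulVec, hxy, pow_zero]
      ext (a | a) <;> simp
    rw [this]
    simp only [sigmaZero, Matrix.fromBlocks_mulVec, Sum.elim_comp_inl, Sum.elim_comp_inr,
      Matrix.one_mulVec, Matrix.zero_mulVec, add_zero, sumElim_dotProduct_sumElim,
      dotProduct_zero]
    simpa [dotProduct, sq] using Finset.sum_mul_sq_le_sq_mul_sq Finset.univ a x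
  -- The first two terms bound `|d t i|` through `|r| ≤ 1 + r ^ 2`; the last bounds `|p t i|`.
  refine ⟨1 + P i i * (x ⬝ᵥ x + K' ^ 2 * (1 - ρ ^ 2)⁻¹) + K, fun t => ?_⟩
  have h2 := sq_dotProduct_le sigmaZero_posSemidef hx0 hd0 hds t (Pi.single i 1)
  have h3 := (hP t).quad_nonneg (Pi.single i 1)
  have h4 := (riccatiSeq_posSemidef (M := M) (c := c) (sigmaZero_posSemidef (n := n) (m := m))
    t).quad_nonneg (Pi.single i 1)
  simp only [Matrix.mulVec_single_one, single_one_dotProduct, Matrix.col_apply, Matrix.sub_apply,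
    neg_sq] at h2 h3 h4
  have h5 : closedProd M c (sigmaZero n m) t i j = d t i + p t i := by
    simp [hd]
  have h6 : (d t i) ^ 2 ≤ P i i * (x ⬝ᵥ x + K' ^ 2 * (1 - ρ ^ 2)⁻¹) :=
    h2.trans (mul_le_mul (by linarith) (by linarith [hsum t])
      (add_nonneg hx0 (Finset.sum_nonneg fun _ _ => sq_nonneg _)) (by linarith))
  have h7 : |d t i| ≤ 1 + P i i * (x ⬝ᵥ x + K' ^ 2 * (1 - ρ ^ 2)⁻¹) := by
    rw [← sq_abs] at h6
    nlinarith [sq_nonneg (|d t i| - 1), abs_nonneg (d t i)]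
  have h8 : |p t i| ≤ K := (hpb t i).trans
    (mul_le_of_le_one_right hK (pow_le_one₀ h0.le h1.le))
  rw [h5]
  exact (abs_add_le _ _).trans (add_le_add h7 h8)

/-- The kernel vectors express the last `m` columns through the first `n + 1`, which caps the rank.
-/
theorem eq_mul_fromCols_of_vanish {S : Matrix (Fin (n + 1) ⊕ Fin m) (Fin (n + 1) ⊕ Fin m) ℝ}
    {T : Matrix (Fin m) (Fin (n + 1)) ℝ} (h : ∀ b, S *ᵥ Sum.elim (-(Tᵀ *ᵥ b)) b = 0) :
    S = S.submatrix id Sum.inl * Matrix.fromCols 1 Tᵀ := by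
  ext i (j | j)
  · simp [Matrix.mul_apply, Matrix.one_apply]
  · have h1 := congrFun (h (Pi.single j 1)) i
    simp only [Matrix.mulVec, dotProduct, Fintype.sum_sum_type, Sum.elim_inl, Sum.elim_inr,
      Pi.neg_apply, Pi.single_apply, mul_ite, mul_one, mul_zero, Finset.sum_ite_eq',
      Finset.mem_univ, if_true, Pi.zero_apply, Matrix.transpose_apply, mul_neg,
      Finset.sum_neg_distrib] at h1
    simp only [Matrix.mul_apply, Matrix.submatrix_apply, id, Matrix.fromCols_apply_inr,
      Matrix.transpose_apply]
    linarith

theorem rank_eq_of_antistable (hF : IsSchurStable F) (hA : ∀ z ∈ eigs A, 1 < ‖z‖)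
    {S : Matrix (Fin (n + 1) ⊕ Fin m) (Fin (n + 1) ⊕ Fin m) ℝ} (hSp : S.PosSemidef)
    (hS : IsStabilizingSolution (bigA A C F G) (bigC C H) S) : S.rank = n + 1 := by
  set M := bigA A C F G with hM
  set c := bigC C H with hc
  set Y := closedLoop M c (gain M c S) with hY
  have hMT : ∀ x y, Mᵀ *ᵥ Sum.elim x y = Sum.elim (Aᵀ *ᵥ x + (G ⬝ᵥ y) • C) (Fᵀ *ᵥ y) := by
    intro x y
    rw [hM, bigA, Matrix.fromBlocks_transpose, Matrix.fromBlocks_mulVec,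
      Matrix.transpose_vecMulVec]
    simp [Matrix.vecMulVec_mulVec]
  have hit : ∀ t : ℕ, S = Y ^ t * S * (M ^ t)ᵀ := by
    intro t
    induction t with
    | zero => simp
    | succ t ih =>
      calc S = Y * S * Mᵀ := hS.eq.trans riccatiMap_eq_closedLoop_mul
        _ = Y * (Y ^ t * S * (M ^ t)ᵀ) * Mᵀ := by rw [← ih]
        _ = _ := by simp only [pow_succ', Matrix.transpose_mul, Matrix.mul_assoc]
  apply le_antisymm
  -- Upper bound: on the vectors `(-Tᵀ b, b)`, `Mᵀ` acts as `Fᵀ` on `b`, so `S = Y ^ t S (M ^ t)ᵀ`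
  -- tends to zero on them.
  · obtain ⟨T, hT⟩ := exists_sylvester hA hF (vecMulVec G C)
    have hv : ∀ b, Mᵀ *ᵥ Sum.elim (-(Tᵀ *ᵥ b)) b = Sum.elim (-(Tᵀ *ᵥ (Fᵀ *ᵥ b))) (Fᵀ *ᵥ b) := by
      intro b
      rw [hMT]
      congr 1
      have h1 := congrArg (fun Z => Zᵀ *ᵥ b) hT
      simp only [Matrix.transpose_mul, Matrix.transpose_add, Matrix.transpose_vecMulVec,
        Matrix.add_mulVec, Matrix.vecMulVec_mulVec, ← Matrix.mulVec_mulVec] at h1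
      rw [Matrix.mulVec_neg, h1]
      simp
    have hvt : ∀ (t : ℕ) b, (M ^ t)ᵀ *ᵥ Sum.elim (-(Tᵀ *ᵥ b)) b =
        Sum.elim (-(Tᵀ *ᵥ (Fᵀ ^ t *ᵥ b))) (Fᵀ ^ t *ᵥ b) := by
      intro t
      induction t with
      | zero => simp
      | succ t ih =>
        intro b
        rw [pow_succ, Matrix.transpose_mul, ← Matrix.mulVec_mulVec, ih, hv,
          Matrix.mulVec_mulVec (M := Fᵀ), ← pow_succ']
    have hz : ∀ b, S *ᵥ Sum.elim (-(Tᵀ *ᵥ b)) b = 0 := by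
      intro b
      have h1 : ∀ t : ℕ, S *ᵥ Sum.elim (-(Tᵀ *ᵥ b)) b =
          (Y ^ t) *ᵥ (S *ᵥ Sum.elim (-(Tᵀ *ᵥ (Fᵀ ^ t *ᵥ b))) (Fᵀ ^ t *ᵥ b)) := by
        intro t
        conv_lhs => rw [hit t]
        rw [← Matrix.mulVec_mulVec, hvt, ← Matrix.mulVec_mulVec]
      have hF0 : Tendsto (fun t : ℕ => Fᵀ ^ t *ᵥ b) atTop (𝓝 (0 *ᵥ b)) :=
        ((continuous_id.matrix_mulVec continuous_const).tendsto _).comp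
          hF.transpose.tendsto_pow
      have hg : Continuous fun p : Matrix (Fin (n + 1) ⊕ Fin m) (Fin (n + 1) ⊕ Fin m) ℝ ×
          (Fin m → ℝ) => p.1 *ᵥ (S *ᵥ Sum.elim (-(Tᵀ *ᵥ p.2)) p.2) := by
        refine continuous_fst.matrix_mulVec (continuous_const.matrix_mulVec ?_)
        refine continuous_pi ?_
        rintro (a | a)
        · simp only [Sum.elim_inl]
          fun_prop
        · simp only [Sum.elim_inr]
          fun_prop
      have h2 := (hg.tendsto (0, 0 *ᵥ b)).comp (hS.stable.tendsto_pow.prodMk_nhds hF0)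
      have h3 := tendsto_nhds_unique (tendsto_const_nhds.congr h1) h2
      simpa using h3
    rw [eq_mul_fromCols_of_vanish hz]
    refine (Matrix.rank_mul_le_right _ _).trans ((Matrix.rank_le_card_height _).trans ?_)
    simp
  -- Lower bound: both nonnegative terms of the fixed-point identity vanish at a kernel vector `(x,
  -- 0)`. Hence the gain is orthogonal to it and `Yᵀ` maps it to `(Aᵀ x, 0)`, again in the kernel;
  -- stability of `Y` and antistability of `A` force `x = 0`.
  · have hker : ∀ x, S *ᵥ Sum.elim x 0 = 0 → x = 0 := by
      intro x hx
      have hstep : ∀ u, S *ᵥ Sum.elim u 0 = 0 →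
          Yᵀ *ᵥ Sum.elim u 0 = Sum.elim (Aᵀ *ᵥ u) 0 ∧ S *ᵥ Sum.elim (Aᵀ *ᵥ u) 0 = 0 := by
        intro u hu
        have h1 : (Sum.elim u 0) ⬝ᵥ (S *ᵥ Sum.elim u 0) = 0 := by rw [hu, dotProduct_zero]
        nth_rw 1 [hS.eq] at h1
        rw [riccatiMap_eq_closedLoop hS.symm hS.denom,
          Matrix.add_mulVec, dotProduct_add, dotProduct_conj_mulVec,
          dotProduct_vecMulVec_mulVec, ← hY] at h1
        have h2 := hSp.quad_nonneg (Yᵀ *ᵥ Sum.elim u 0)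
        have h3 : gain M c S ⬝ᵥ Sum.elim u 0 = 0 := by nlinarith
        have h4 : Yᵀ *ᵥ Sum.elim u 0 = Sum.elim (Aᵀ *ᵥ u) 0 := by
          rw [hY, closedLoop_transpose, Matrix.sub_mulVec, Matrix.vecMulVec_mulVec, h3, hMT]
          simp
        refine ⟨h4, ?_⟩
        rw [← h4]
        rw [h3, mul_zero, add_zero] at h1
        exact (hSp.dotProduct_mulVec_zero_iff _).1 (by simpa using h1)
      have hind : ∀ t : ℕ, S *ᵥ Sum.elim (Aᵀ ^ t *ᵥ x) 0 = 0 ∧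
          Yᵀ ^ t *ᵥ Sum.elim x 0 = Sum.elim (Aᵀ ^ t *ᵥ x) 0 := by
        intro t
        induction t with
        | zero => simpa using hx
        | succ t ih =>
          obtain ⟨h1, h2⟩ := hstep _ ih.1
          rw [Matrix.mulVec_mulVec, ← pow_succ'] at h1 h2
          exact ⟨h2, by rw [pow_succ', ← Matrix.mulVec_mulVec, ih.2, h1]⟩
      refine eq_zero_of_tendsto_pow_mulVec (A := Aᵀ) (by rwa [eigs_transpose]) ?_
      have h1 : Tendsto (fun t : ℕ => Yᵀ ^ t *ᵥ Sum.elim x 0) atTop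
          (𝓝 (0 *ᵥ Sum.elim x 0)) :=
        ((continuous_id.matrix_mulVec continuous_const).tendsto _).comp
          hS.stable.transpose.tendsto_pow
      simp_rw [fun t => (hind t).2, Matrix.zero_mulVec] at h1
      exact tendsto_pi_nhds.2 fun a => tendsto_pi_nhds.1 h1 (Sum.inl a)
    let f : (Fin (n + 1) → ℝ) →ₗ[ℝ] (Fin (n + 1) ⊕ Fin m → ℝ) :=
      S.mulVecLin ∘ₗ (Matrix.fromRows (1 : Matrix (Fin (n + 1)) (Fin (n + 1)) ℝ)
        (0 : Matrix (Fin m) (Fin (n + 1)) ℝ)).mulVecLin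
    have hf : Function.Injective f := by
      rw [← LinearMap.ker_eq_bot, LinearMap.ker_eq_bot']
      intro x hx
      refine hker x ?_
      simpa [f, Matrix.fromRows_mulVec] using hx
    have h1 := LinearMap.finrank_range_of_inj hf
    rw [Module.finrank_fin_fun] at h1
    refine h1.symm.trans_le ?_
    exact Submodule.finrank_mono (LinearMap.range_comp_le_range _ _)

end BlockSystem

/-! ### Mean-square comparison with the steady-state system -/

section MeanSquare

variable {ι : Type*} [Fintype ι]

theorem tendsto_zero_of_affine_recursion {u a b : ℕ → ℝ} {ρ : ℝ} (hρ : ρ < 1) (hu : ∀ t, 0 ≤ u t)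
    (ha : Tendsto a atTop (𝓝 ρ)) (hb : Tendsto b atTop (𝓝 0))
    (h : ∀ t, u (t + 1) ≤ a t * u t + b t) : Tendsto u atTop (𝓝 0) := by
  obtain ⟨σ, hσ1, hσ2⟩ := exists_between (max_lt hρ zero_lt_one)
  have hσρ : ρ < σ := (le_max_left _ _).trans_lt hσ1
  have hσ0 : 0 < σ := (le_max_right _ _).trans_lt hσ1
  rw [Metric.tendsto_atTop]
  intro δ hδ
  obtain ⟨T, hT⟩ := eventually_atTop.1 ((ha.eventually (gt_mem_nhds hσρ)).and
    -- With this forcing bound, `δ / 2` is the fixed level of the contraction by `σ`.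
    (hb.eventually (gt_mem_nhds (show 0 < δ / 2 * (1 - σ) by
      have := sub_pos.2 hσ2
      positivity))))
  have hstep : ∀ k : ℕ, u (T + k) ≤ σ ^ k * u T + δ / 2 := by
    intro k
    induction k with
    | zero => simp; linarith
    | succ k ih =>
      obtain ⟨h1, h2⟩ := hT (T + k) (Nat.le_add_right _ _)
      have h3 := mul_le_mul_of_nonneg_right h1.le (hu (T + k))
      have h4 := mul_le_mul_of_nonneg_left ih hσ0.le
      have h5 := h (T + k)
      rw [← add_assoc, pow_succ]
      nlinarith
  have hlim : Tendsto (fun k : ℕ => σ ^ k * u T) atTop (𝓝 0) := by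
    simpa using (tendsto_pow_atTop_nhds_zero_of_lt_one hσ0.le hσ2).mul_const (u T)
  obtain ⟨K, hK⟩ := eventually_atTop.1 (hlim.eventually (gt_mem_nhds (half_pos hδ)))
  refine ⟨T + K, fun t ht => ?_⟩
  obtain ⟨k, rfl⟩ := Nat.exists_eq_add_of_le (show T ≤ t by omega)
  rw [Real.dist_eq, sub_zero, abs_of_nonneg (hu _)]
  have := hK k (by omega)
  linarith [hstep k]

theorem norm_mulVec_le (E : Matrix ι ι ℝ) (x : ι → ℝ) :
    ‖E *ᵥ x‖ ≤ (∑ i, ∑ j, |E i j|) * ‖x‖ := by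
  refine (pi_norm_le_iff_of_nonneg (by positivity)).2 fun i => ?_
  calc ‖(E *ᵥ x) i‖ ≤ ∑ j, |E i j| * ‖x‖ := by
        rw [Matrix.mulVec, dotProduct]
        refine (norm_sum_le _ _).trans (Finset.sum_le_sum fun j _ => ?_)
        rw [norm_mul]
        exact mul_le_mul_of_nonneg_left (norm_le_pi_norm x j) (abs_nonneg _)
    _ = (∑ j, |E i j|) * ‖x‖ := by rw [Finset.sum_mul]
    _ ≤ _ := by
        exact mul_le_mul_of_nonneg_right (Finset.single_le_sum (f := fun i => ∑ j, |E i j|)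
          (fun i _ => Finset.sum_nonneg fun j _ => abs_nonneg _) (Finset.mem_univ i))
          (norm_nonneg x)

theorem abs_dotProduct_le (c x : ι → ℝ) : |c ⬝ᵥ x| ≤ (∑ i, |c i|) * ‖x‖ := by
  rw [dotProduct, Finset.sum_mul]
  refine (Finset.abs_sum_le_sum_abs _ _).trans (Finset.sum_le_sum fun i _ => ?_)
  rw [abs_mul]
  exact mul_le_mul_of_nonneg_left (norm_le_pi_norm x i) (abs_nonneg _)

theorem IsSchurStable.exists_norm_pow_mulVec_le [DecidableEq ι] {Y : Matrix ι ι ℝ}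
    (hY : IsSchurStable Y) :
    ∃ C ρ : ℝ, 0 ≤ C ∧ 0 < ρ ∧ ρ < 1 ∧ ∀ (t : ℕ) x, ‖Y ^ t *ᵥ x‖ ≤ C * ρ ^ t * ‖x‖ := by
  obtain ⟨C, ρ, hC, h0, h1, hb⟩ := hY.exists_pow_bound
  refine ⟨∑ _i : ι, ∑ _j : ι, C, ρ, by positivity, h0, h1, fun t x => (norm_mulVec_le _ x).trans ?_⟩
  gcongr
  simp only [Finset.sum_mul]
  exact Finset.sum_le_sum fun i _ => Finset.sum_le_sum fun j _ => hb t i j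

variable {Ω : Type*} [MeasurableSpace Ω] {P : Measure Ω}

/-- The real-valued root mean square of a random vector. -/
def rms {E : Type*} [NormedAddCommGroup E] (P : Measure Ω) (f : Ω → E) : ℝ :=
  (eLpNorm f 2 P).toReal

theorem rms_nonneg {E : Type*} [NormedAddCommGroup E] (f : Ω → E) : 0 ≤ rms P f :=
  ENNReal.toReal_nonneg

theorem rms_add_le {E : Type*} [NormedAddCommGroup E] {f g : Ω → E} (hf : MemLp f 2 P)
    (hg : MemLp g 2 P) : rms P (fun ω => f ω + g ω) ≤ rms P f + rms P g := by
  rw [rms, rms, rms, ← ENNReal.toReal_add hf.eLpNorm_ne_top hg.eLpNorm_ne_top]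
  exact ENNReal.toReal_mono (ENNReal.add_ne_top.2 ⟨hf.eLpNorm_ne_top, hg.eLpNorm_ne_top⟩)
    (eLpNorm_add_le hf.1 hg.1 (by norm_num))

theorem rms_le_mul {E E' : Type*} [NormedAddCommGroup E] [NormedAddCommGroup E'] {f : Ω → E}
    {g : Ω → E'} {k : ℝ} (hk : 0 ≤ k) (hg : MemLp g 2 P) (h : ∀ ω, ‖f ω‖ ≤ k * ‖g ω‖) :
    rms P f ≤ k * rms P g := by
  rw [rms, rms, ← ENNReal.toReal_ofReal hk, ← ENNReal.toReal_mul]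
  exact ENNReal.toReal_mono (ENNReal.mul_ne_top ENNReal.ofReal_ne_top hg.eLpNorm_ne_top)
    (eLpNorm_le_mul_eLpNorm_of_ae_le_mul (ae_of_all _ h) _)

theorem memLp_mulVec (E : Matrix ι ι ℝ) {f : Ω → ι → ℝ} (hf : MemLp f 2 P) :
    MemLp (fun ω => E *ᵥ f ω) 2 P :=
  (LinearMap.toContinuousLinearMap E.mulVecLin).comp_memLp' hf

theorem memLp_smul_const {f : Ω → ℝ} (hf : MemLp f 2 P) (l : ι → ℝ) :
    MemLp (fun ω => f ω • l) 2 P :=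
  ((ContinuousLinearMap.id ℝ ℝ).smulRight l).comp_memLp' hf

/-- `Y` need not contract in one step. Bounding `rms P (Y ^ j Z t)` by `ρ ^ j * u t` for all `j` at
once plays the role of an adapted norm and yields a scalar recursion with rate `ρ`. -/
theorem IsSchurStable.exists_majorant [DecidableEq ι] {Y : Matrix ι ι ℝ} (hY : IsSchurStable Y) :
    ∃ C ρ : ℝ, 0 ≤ C ∧ 0 < ρ ∧ ρ < 1 ∧ ∀ (Z R : ℕ → Ω → ι → ℝ) (ε b : ℕ → ℝ),
      (∀ t, MemLp (Z t) 2 P) → (∀ t, MemLp (R t) 2 P) →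
      (∀ t ω, Z (t + 1) ω = Y *ᵥ Z t ω + R t ω) → (∀ t, 0 ≤ ε t) →
      (∀ t, rms P (R t) ≤ ε t * rms P (Z t) + b t) →
      ∃ u : ℕ → ℝ, (∀ t, rms P (Z t) ≤ u t) ∧ ∀ t, u (t + 1) = (ρ + C * ε t) * u t + C * b t := by
  obtain ⟨C, ρ, hC, h0, h1, hb⟩ := hY.exists_norm_pow_mulVec_le
  refine ⟨C, ρ, hC, h0, h1, fun Z R ε b hZ hR hZR hε hRb => ?_⟩
  let u : ℕ → ℝ := fun t => Nat.rec (C * rms P (Z 0)) (fun t v => (ρ + C * ε t) * v + C * b t) t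
  have hus : ∀ t, u (t + 1) = (ρ + C * ε t) * u t + C * b t := fun t => rfl
  have key : ∀ t j : ℕ, rms P (fun ω => Y ^ j *ᵥ Z t ω) ≤ ρ ^ j * u t := by
    intro t
    induction t with
    | zero =>
      intro j
      refine (rms_le_mul (by positivity) (hZ 0) fun ω => hb j (Z 0 ω)).trans (le_of_eq ?_)
      change _ = ρ ^ j * (C * rms P (Z 0))
      ring
    | succ t ih =>
      intro j
      have h2 := ih (j + 1)
      have h3 := ih 0
      simp only [pow_zero, Matrix.one_mulVec, one_mul] at h3
      have h4 := rms_le_mul (by positivity) (hR t) fun ω => hb j (R t ω)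
      have h5 := rms_add_le (memLp_mulVec (Y ^ (j + 1)) (hZ t)) (memLp_mulVec (Y ^ j) (hR t))
      have h6 : (fun ω => Y ^ j *ᵥ Z (t + 1) ω) =
          fun ω => Y ^ (j + 1) *ᵥ Z t ω + Y ^ j *ᵥ R t ω := by
        funext ω
        rw [hZR, Matrix.mulVec_add, Matrix.mulVec_mulVec, ← pow_succ]
      rw [h6, hus]
      have h7 : rms P (R t) ≤ ε t * u t + b t :=
        (hRb t).trans (by linarith [mul_le_mul_of_nonneg_left h3 (hε t)])
      calc _ ≤ ρ ^ (j + 1) * u t + C * ρ ^ j * rms P (R t) := by linarith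
        _ ≤ ρ ^ (j + 1) * u t + C * ρ ^ j * (ε t * u t + b t) := by gcongr
        _ = _ := by ring
  refine ⟨u, fun t => ?_, hus⟩
  simpa using key t 0

variable {M : Matrix ι ι ℝ} {c : ι → ℝ} {L : ℕ → ι → ℝ} {N : ℕ → Ω → ℝ}

theorem memLp_stateSeq (L : ℕ → ι → ℝ) {ξ : Ω → ι → ℝ} (hξ : MemLp ξ 2 P)
    (hN : ∀ t, MemLp (N t) 2 P) (t : ℕ) :
    MemLp (fun ω => stateSeq M c L (ξ ω) (fun s => N s ω) t) 2 P := by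
  induction t with
  | zero => exact hξ
  | succ t ih => exact (memLp_mulVec _ ih).sub (memLp_smul_const (hN t) _)

theorem exists_rms_stateSeq_le [DecidableEq ι] {l : ι → ℝ} (hl : IsSchurStable (closedLoop M c l))
    {ξ : Ω → ι → ℝ} (hξ : MemLp ξ 2 P) (hN : ∀ t, MemLp (N t) 2 P) {ν : ℝ}
    (hν : ∀ t, rms P (N t) ≤ ν) :
    ∃ B, ∀ t, rms P (fun ω => stateSeq M c (fun _ => l) (ξ ω) (fun s => N s ω) t) ≤ B := by
  obtain ⟨C, ρ, hC, h0, h1, h⟩ := hl.exists_majorant (P := P)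
  obtain ⟨u, hu, hus⟩ := h (fun t ω => stateSeq M c (fun _ => l) (ξ ω) (fun s => N s ω) t)
    (fun t ω => N t ω • (-l)) (fun _ => 0) (fun _ => ‖l‖ * ν)
    (memLp_stateSeq _ hξ hN) (fun t => memLp_smul_const (hN t) _)
    (fun t ω => by rw [stateSeq, smul_neg, sub_eq_add_neg]) (fun _ => le_rfl) (fun t => by
      rw [zero_mul, zero_add]
      refine (rms_le_mul (norm_nonneg l) (hN t) fun ω => ?_).trans (by gcongr; exact hν t)
      rw [norm_smul, norm_neg, mul_comm])
  have hν0 : 0 ≤ ν := (rms_nonneg _).trans (hν 0)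
  have hp : 0 < 1 - ρ := sub_pos.2 h1
  refine ⟨|u 0| + C * (‖l‖ * ν) / (1 - ρ), fun t => (hu t).trans ?_⟩
  induction t with
  | zero =>
    have : 0 ≤ C * (‖l‖ * ν) / (1 - ρ) := by positivity
    linarith [le_abs_self (u 0)]
  | succ t ih =>
    rw [hus, mul_zero, add_zero]
    have h2 := mul_le_mul_of_nonneg_left ih h0.le
    have h3 : C * (‖l‖ * ν) / (1 - ρ) * (1 - ρ) = C * (‖l‖ * ν) := div_mul_cancel₀ _ hp.ne'
    nlinarith [abs_nonneg (u 0)]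

/-- With `E t` the closed-loop error, the difference is driven by `E t` applied to itself, by `E t`
applied to the steady state (bounded in mean square), and by the gain error times noise. All these
coefficients vanish in the limit. -/
theorem tendsto_rms_stateSeq_sub [DecidableEq ι] {l : ι → ℝ} (hl : IsSchurStable (closedLoop M c l))
    (hL : Tendsto L atTop (𝓝 l))
    {ξ ξ' : Ω → ι → ℝ} (hξ : MemLp ξ 2 P) (hξ' : MemLp ξ' 2 P) (hN : ∀ t, MemLp (N t) 2 P) {ν : ℝ}
    (hν : ∀ t, rms P (N t) ≤ ν) :
    Tendsto (fun t => rms P (fun ω => stateSeq M c L (ξ ω) (fun s => N s ω) t -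
      stateSeq M c (fun _ => l) (ξ' ω) (fun s => N s ω) t)) atTop (𝓝 0) := by
  obtain ⟨B, hB⟩ := exists_rms_stateSeq_le hl hξ' hN hν
  obtain ⟨C, ρ, hC, h0, h1, h⟩ := hl.exists_majorant (P := P)
  set X : ℕ → Ω → ι → ℝ := fun t ω => stateSeq M c L (ξ ω) (fun s => N s ω) t with hX
  set X' : ℕ → Ω → ι → ℝ := fun t ω => stateSeq M c (fun _ => l) (ξ' ω) (fun s => N s ω) t with hX'
  have hXm : ∀ t, MemLp (X t) 2 P := memLp_stateSeq _ hξ hN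
  have hXm' : ∀ t, MemLp (X' t) 2 P := memLp_stateSeq _ hξ' hN
  have hDm : ∀ t, MemLp (fun ω => X t ω - X' t ω) 2 P := fun t => (hXm t).sub (hXm' t)
  set E : ℕ → Matrix ι ι ℝ := fun t => closedLoop M c (L t) - closedLoop M c l with hE
  set ε : ℕ → ℝ := fun t => ∑ i, ∑ j, |E t i j| with hεd
  have hε0 : ∀ t, 0 ≤ ε t := fun t => by positivity
  have hε : Tendsto ε atTop (𝓝 0) := by
    have hE0 : Tendsto E atTop (𝓝 0) := by
      rw [← sub_self (closedLoop M c l)]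
      exact ((continuous_closedLoop.tendsto l).comp hL).sub_const _
    have hc : Continuous fun E : Matrix ι ι ℝ => ∑ i, ∑ j, |E i j| := by fun_prop
    have h2 := (hc.tendsto 0).comp hE0
    simp only [Matrix.zero_apply, abs_zero, Finset.sum_const_zero] at h2
    exact h2
  have hLl : Tendsto (fun t => ‖L t - l‖) atTop (𝓝 0) := by
    simpa using (hL.sub_const l).norm
  set b : ℕ → ℝ := fun t => ε t * B + ‖L t - l‖ * ν with hbd
  have hb : Tendsto b atTop (𝓝 0) := by
    simpa using (hε.mul_const B).add (hLl.mul_const ν)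
  obtain ⟨u, hu, hus⟩ := h (fun t ω => X t ω - X' t ω)
    (fun t ω => E t *ᵥ (X t ω - X' t ω) + (E t *ᵥ X' t ω + N t ω • (l - L t))) ε b hDm
    (fun t => (memLp_mulVec _ (hDm t)).add
      ((memLp_mulVec _ (hXm' t)).add (memLp_smul_const (hN t) _)))
    (fun t ω => by
      simp only [hX, hX', hE, stateSeq]
      rw [Matrix.sub_mulVec, Matrix.sub_mulVec, Matrix.mulVec_sub, Matrix.mulVec_sub]
      module) hε0 (fun t => by
      refine (rms_add_le (memLp_mulVec _ (hDm t))
        ((memLp_mulVec _ (hXm' t)).add (memLp_smul_const (hN t) _))).trans (add_le_add ?_ ?_)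
      · exact rms_le_mul (hε0 t) (hDm t) fun ω => norm_mulVec_le _ _
      · refine (rms_add_le (memLp_mulVec _ (hXm' t)) (memLp_smul_const (hN t) _)).trans
          (add_le_add ?_ ?_)
        · refine (rms_le_mul (hε0 t) (hXm' t) fun ω => norm_mulVec_le _ _).trans ?_
          exact mul_le_mul_of_nonneg_left (hB t) (hε0 t)
        · refine (rms_le_mul (norm_nonneg (L t - l)) (hN t) fun ω => ?_).trans
            (mul_le_mul_of_nonneg_left (hν t) (norm_nonneg _))
          rw [norm_smul, norm_sub_rev, mul_comm])
  have hu0 : Tendsto u atTop (𝓝 0) := by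
    refine tendsto_zero_of_affine_recursion (a := fun t => ρ + C * ε t) (b := fun t => C * b t) h1
      (fun t => (rms_nonneg _).trans (hu t)) ?_ (by simpa using hb.const_mul C)
      fun t => (hus t).le
    simpa using (hε.const_mul C).const_add ρ
  exact squeeze_zero (fun t => rms_nonneg _) hu hu0

theorem tendsto_eLpNorm_of_le_rms {E E' : Type*} [NormedAddCommGroup E] [NormedAddCommGroup E']
    {f : ℕ → Ω → E} {g : ℕ → Ω → E'} (k : ℝ) (hg : ∀ t, MemLp (g t) 2 P)
    (h : ∀ t ω, ‖f t ω‖ ≤ k * ‖g t ω‖) (hlim : Tendsto (fun t => rms P (g t)) atTop (𝓝 0)) :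
    Tendsto (fun t => eLpNorm (f t) 2 P) atTop (𝓝 0) := by
  have h1 : Tendsto (fun t => ENNReal.ofReal k * ENNReal.ofReal (rms P (g t))) atTop (𝓝 0) := by
    have h2 := ENNReal.Tendsto.const_mul (a := ENNReal.ofReal k) (ENNReal.tendsto_ofReal hlim)
      (Or.inr ENNReal.ofReal_ne_top)
    simpa using h2
  refine tendsto_of_tendsto_of_tendsto_of_le_of_le tendsto_const_nhds h1 (fun t => zero_le)
    fun t => ?_
  refine (eLpNorm_le_mul_eLpNorm_of_ae_le_mul (ae_of_all _ (h t)) 2).trans (le_of_eq ?_)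
  rw [rms, ENNReal.ofReal_toReal (hg t).eLpNorm_ne_top]

/-- Mean-square convergence to the steady-state system driven by the same noise. -/
theorem tendsto_eLpNorm_sub [DecidableEq ι] {l : ι → ℝ} (hl : IsSchurStable (closedLoop M c l))
    (hL : Tendsto L atTop (𝓝 l)) (hN : ∀ t, HasLaw (N t) (gaussianReal 0 1) P) (d : ι → ℝ)
    {ξ ξ' : Ω → ι → ℝ} (hξ : MemLp ξ 2 P) (hξ' : MemLp ξ' 2 P) :
    Tendsto (fun t => eLpNorm (fun ω => stateSeq M c L (ξ ω) (fun s => N s ω) t -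
      stateSeq M c (fun _ => l) (ξ' ω) (fun s => N s ω) t) 2 P) atTop (𝓝 0) ∧
    Tendsto (fun t => eLpNorm (fun ω => innovSeq M c L (ξ ω) (fun s => N s ω) t -
      innovSeq M c (fun _ => l) (ξ' ω) (fun s => N s ω) t) 2 P) atTop (𝓝 0) ∧
    Tendsto (fun t => eLpNorm (fun ω => inputSeq M c d L (ξ ω) (fun s => N s ω) t -
      inputSeq M c d (fun _ => l) (ξ' ω) (fun s => N s ω) t) 2 P) atTop (𝓝 0) := by
  have hid : MemLp (id : ℝ → ℝ) 2 (gaussianReal 0 1) := memLp_id_gaussianReal' 2 (by simp)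
  have hNm : ∀ t, MemLp (N t) 2 P := fun t => by
    have h1 := (hN t).map_eq ▸ hid
    exact h1.comp_of_map (hN t).aemeasurable
  have hν : ∀ t, rms P (N t) ≤ rms (gaussianReal 0 1) (id : ℝ → ℝ) := fun t => by
    refine le_of_eq ?_
    rw [rms, rms, ← (hN t).map_eq, eLpNorm_map_measure (by fun_prop) (hN t).aemeasurable]
    rfl
  have hlim := tendsto_rms_stateSeq_sub hl hL hξ hξ' hNm hν
  have hm := fun t => (memLp_stateSeq (M := M) (c := c) L hξ hNm t).sub
    (memLp_stateSeq (M := M) (c := c) (fun _ => l) hξ' hNm t)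
  refine ⟨tendsto_eLpNorm_of_le_rms 1 hm (fun t ω => (one_mul _).ge) hlim,
    tendsto_eLpNorm_of_le_rms (∑ i, |c i|) hm (fun t ω => ?_) hlim,
    tendsto_eLpNorm_of_le_rms (∑ i, |d i|) hm (fun t ω => ?_) hlim⟩
  · refine le_trans (le_of_eq ?_) (abs_dotProduct_le c _)
    rw [Real.norm_eq_abs, innovSeq, innovSeq, Pi.sub_apply, dotProduct_sub, add_sub_add_right_eq_sub]
  · refine le_trans (le_of_eq ?_) (abs_dotProduct_le d _)
    rw [Real.norm_eq_abs, inputSeq, inputSeq, Pi.sub_apply, dotProduct_sub]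

end MeanSquare

/-! ### Characteristic functions and the stationary law -/

section Laws

variable {ι : Type*} [Fintype ι]

/-- When the phase splits into a state part and a noise part, independence factorizes the
characteristic function. This serves both the state update and the innovation. -/
theorem charFun_map_prod_gaussian {F : Type*} [NormedAddCommGroup F] [InnerProductSpace ℝ F]
    [MeasurableSpace F] [BorelSpace F] [SecondCountableTopology F]
    (μ : Measure (EuclideanSpace ℝ ι)) [IsProbabilityMeasure μ]
    {g : EuclideanSpace ℝ ι × ℝ → F} (hg : Measurable g) {w : F} {v : EuclideanSpace ℝ ι} {b : ℝ}
    (h : ∀ p, inner ℝ (g p) w = inner ℝ p.1 v + p.2 * b) :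
    charFun ((μ.prod (gaussianReal 0 1)).map g) w =
      charFun μ v * Complex.exp (-(b ^ 2 / 2 : ℝ)) := by
  have hγ : ∫ s, Complex.exp ((s * b : ℝ) * Complex.I) ∂(gaussianReal 0 1) =
      Complex.exp (-(b ^ 2 / 2 : ℝ)) := by
    have h1 := charFun_gaussianReal (μ := 0) (v := 1) b
    rw [charFun_apply_real] at h1
    simp only [Complex.ofReal_mul, mul_comm (Complex.ofReal _) (b : ℂ)]
    rw [h1]
    congr 1
    push_cast
    ring
  rw [charFun_apply, integral_map hg.aemeasurable (by fun_prop), charFun_apply, ← hγ,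
    ← integral_prod_mul]
  refine integral_congr_ae (ae_of_all _ fun p => ?_)
  simp only [h, Complex.ofReal_add, add_mul, Complex.exp_add]

theorem charFun_gaussianReal_toNNReal {v : ℝ} (hv : 0 ≤ v) (s : ℝ) :
    charFun (gaussianReal 0 v.toNNReal) s = Complex.exp (-(s ^ 2 * v / 2 : ℝ)) := by
  have h : ((v.toNNReal : NNReal) : ℂ) = (v : ℂ) := by
    exact_mod_cast congrArg Complex.ofReal (Real.coe_toNNReal v hv)
  rw [charFun_gaussianReal, h]
  congr 1
  push_cast
  ring

theorem tendstoInDistribution_of_charFun {Ω F : Type*} [MeasurableSpace Ω] {P : Measure Ω}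
    [IsProbabilityMeasure P] [NormedAddCommGroup F] [InnerProductSpace ℝ F]
    [FiniteDimensional ℝ F] [MeasurableSpace F] [BorelSpace F] {X : ℕ → Ω → F} {μ : Measure F}
    [IsProbabilityMeasure μ] (hX : ∀ t, AEMeasurable (X t) P)
    (h : ∀ w, Tendsto (fun t => charFun (P.map (X t)) w) atTop (𝓝 (charFun μ w))) :
    TendstoInDistribution X atTop id (fun _ => P) μ where
  forall_aemeasurable := hX
  aemeasurable_limit := aemeasurable_id
  tendsto := ProbabilityMeasure.tendsto_of_tendsto_charFun fun w => by
    simpa using h w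

variable {M : Matrix ι ι ℝ} {c : ι → ℝ}

theorem inner_closedLoop_step (Y : Matrix ι ι ℝ) (l : ι → ℝ) (w : EuclideanSpace ℝ ι)
    (p : EuclideanSpace ℝ ι × ℝ) :
    inner ℝ (WithLp.toLp 2 (Y *ᵥ p.1.ofLp - p.2 • l)) w =
      inner ℝ p.1 (WithLp.toLp 2 (Yᵀ *ᵥ w.ofLp)) + p.2 * (-(l ⬝ᵥ w.ofLp)) := by
  simp only [EuclideanSpace.inner_eq_star_dotProduct, star_trivial]
  rw [dotProduct_sub, dotProduct_smul, Matrix.dotProduct_mulVec, ← Matrix.mulVec_transpose,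
    dotProduct_comm w.ofLp l, smul_eq_mul]
  ring

theorem measurable_closedLoop_step (Y : Matrix ι ι ℝ) (l : ι → ℝ) :
    Measurable fun p : EuclideanSpace ℝ ι × ℝ => WithLp.toLp 2 (Y *ᵥ p.1.ofLp - p.2 • l) := by
  apply Continuous.measurable
  fun_prop

theorem charFun_multivariateGaussian_zero [DecidableEq ι] {S : Matrix ι ι ℝ} (hS : S.PosSemidef)
    (w : EuclideanSpace ℝ ι) :
    charFun (multivariateGaussian 0 S) w =
      Complex.exp (-((w.ofLp ⬝ᵥ (S *ᵥ w.ofLp)) / 2 : ℝ)) := by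
  rw [charFun_multivariateGaussian hS]
  simp

/-- The steady-state system has `𝒩(0, S)` as its only stationary law. -/
theorem isStationaryLaw_iff [DecidableEq ι] {S : Matrix ι ι ℝ} (hSp : S.PosSemidef)
    (hS : IsStabilizingSolution M c S) (μ : Measure (EuclideanSpace ℝ ι)) [IsProbabilityMeasure μ] :
    IsStationaryLaw M c (gain M c S) μ ↔ μ = multivariateGaussian 0 S := by
  set Y := closedLoop M c (gain M c S) with hY
  set l := gain M c S with hl
  have hstep : ∀ (μ : Measure (EuclideanSpace ℝ ι)) [IsProbabilityMeasure μ] w,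
      charFun ((μ.prod (gaussianReal 0 1)).map
        (fun p => WithLp.toLp 2 (Y *ᵥ p.1.ofLp - p.2 • l))) w =
      charFun μ (WithLp.toLp 2 (Yᵀ *ᵥ w.ofLp)) * Complex.exp (-((l ⬝ᵥ w.ofLp) ^ 2 / 2 : ℝ)) := by
    intro μ _ w
    rw [charFun_map_prod_gaussian μ (measurable_closedLoop_step Y l)
      (inner_closedLoop_step Y l w), neg_sq]
  have hq : ∀ w : ι → ℝ, w ⬝ᵥ (S *ᵥ w) =
      (Yᵀ *ᵥ w) ⬝ᵥ (S *ᵥ (Yᵀ *ᵥ w)) + (l ⬝ᵥ w) ^ 2 := by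
    intro w
    conv_lhs => rw [hS.eq, riccatiMap_eq_closedLoop hS.symm hS.denom]
    rw [Matrix.add_mulVec, dotProduct_add, dotProduct_conj_mulVec, dotProduct_vecMulVec_mulVec, sq]
  have hprob : ∀ (μ : Measure (EuclideanSpace ℝ ι)) [IsProbabilityMeasure μ],
      IsProbabilityMeasure ((μ.prod (gaussianReal 0 1)).map
        (fun p => WithLp.toLp 2 (Y *ᵥ p.1.ofLp - p.2 • l))) := fun μ _ =>
    Measure.isProbabilityMeasure_map (measurable_closedLoop_step Y l).aemeasurable
  constructor
  · intro h
    have hμ : ∀ w : ι → ℝ, charFun μ (WithLp.toLp 2 w) =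
        charFun μ (WithLp.toLp 2 (Yᵀ *ᵥ w)) * Complex.exp (-((l ⬝ᵥ w) ^ 2 / 2 : ℝ)) := by
      intro w
      conv_lhs => rw [← h]
      exact hstep μ (WithLp.toLp 2 w)
    -- The ratio of the characteristic functions of `μ` and of the Gaussian. It is continuous and
    -- invariant under `Yᵀ`, whose powers tend to zero, so it equals its value `1` at the origin.
    let ψ : (ι → ℝ) → ℂ := fun w =>
      charFun μ (WithLp.toLp 2 w) * Complex.exp ((w ⬝ᵥ (S *ᵥ w)) / 2 : ℝ)
    have hψ : ∀ w, ψ w = ψ (Yᵀ *ᵥ w) := by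
      intro w
      simp only [ψ]
      rw [hμ w, mul_assoc, ← Complex.exp_add, hq w]
      congr 2
      push_cast
      ring
    have hψt : ∀ (t : ℕ) w, ψ w = ψ (Yᵀ ^ t *ᵥ w) := by
      intro t
      induction t with
      | zero => simp
      | succ t ih =>
        intro w
        rw [pow_succ', ← Matrix.mulVec_mulVec, ← hψ, ih]
    have hψc : Continuous ψ := by
      refine Continuous.mul ?_ ?_
      · exact continuous_charFun.comp (by fun_prop)
      · fun_prop
    have hψ1 : ∀ w, ψ w = 1 := by
      intro w
      have h1 : Tendsto (fun t : ℕ => Yᵀ ^ t *ᵥ w) atTop (𝓝 (0 *ᵥ w)) :=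
        ((continuous_id.matrix_mulVec continuous_const).tendsto _).comp
          hS.stable.transpose.tendsto_pow
      have h2 := (hψc.tendsto _).comp h1
      have h3 := tendsto_nhds_unique (tendsto_const_nhds.congr fun t => hψt t w) h2
      rw [h3]
      simp [ψ]
    refine Measure.ext_of_charFun (funext fun w => ?_)
    rw [charFun_multivariateGaussian_zero hSp, Complex.exp_neg]
    exact eq_inv_of_mul_eq_one_left (hψ1 w.ofLp)
  · rintro rfl
    have := hprob (multivariateGaussian 0 S)
    refine Measure.ext_of_charFun (funext fun w => ?_)
    rw [← hY, hstep, charFun_multivariateGaussian_zero hSp, charFun_multivariateGaussian_zero hSp,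
      ← Complex.exp_add, hq w.ofLp]
    congr 1
    push_cast
    ring

end Laws

/-! ### Laws of the time-varying signals -/

section Signals

variable {n m : ℕ} {M : Matrix (Fin (n + 1) ⊕ Fin m) (Fin (n + 1) ⊕ Fin m) ℝ}
  {c : Fin (n + 1) ⊕ Fin m → ℝ} {Ω : Type*} [MeasurableSpace Ω] {P : Measure Ω}
  {W : Fin (n + 1) → Ω → ℝ} {N : ℕ → Ω → ℝ}
  {L : ℕ → Fin (n + 1) ⊕ Fin m → ℝ}

/-- The state of the system started from `(W, 0)`, as a random vector in Euclidean space. -/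
abbrev stateVec (M : Matrix (Fin (n + 1) ⊕ Fin m) (Fin (n + 1) ⊕ Fin m) ℝ)
    (c : Fin (n + 1) ⊕ Fin m → ℝ) (L : ℕ → Fin (n + 1) ⊕ Fin m → ℝ) (W : Fin (n + 1) → Ω → ℝ)
    (N : ℕ → Ω → ℝ) (t : ℕ) (ω : Ω) : EuclideanSpace ℝ (Fin (n + 1) ⊕ Fin m) :=
  WithLp.toLp 2 (stateSeq M c L (Sum.elim (fun i => W i ω) 0) (fun s => N s ω) t)

/-- The gains along the Riccati recursion started from `diag(I, 0)`. -/
abbrev riccatiGain (M : Matrix (Fin (n + 1) ⊕ Fin m) (Fin (n + 1) ⊕ Fin m) ℝ)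
    (c : Fin (n + 1) ⊕ Fin m → ℝ) (t : ℕ) : Fin (n + 1) ⊕ Fin m → ℝ :=
  gain M c (riccatiSeq M c (sigmaZero n m) t)

theorem stateSeq_congr {ι : Type*} [Fintype ι] {M : Matrix ι ι ℝ} {c : ι → ℝ} {L : ℕ → ι → ℝ}
    (x : ι → ℝ) {N N' : ℕ → ℝ} {t : ℕ} (h : ∀ s < t, N s = N' s) :
    stateSeq M c L x N t = stateSeq M c L x N' t := by
  induction t with
  | zero => rfl
  | succ t ih => rw [stateSeq, stateSeq, ih fun s hs => h s (hs.trans t.lt_succ_self),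
      h t t.lt_succ_self]

theorem continuous_stateSeq {ι X : Type*} [Fintype ι] [TopologicalSpace X] {M : Matrix ι ι ℝ}
    {c : ι → ℝ} {L : ℕ → ι → ℝ} {x : X → ι → ℝ} (hx : Continuous x) {N : ℕ → X → ℝ}
    (hN : ∀ s, Continuous (N s)) (t : ℕ) :
    Continuous fun z => stateSeq M c L (x z) (fun s => N s z) t := by
  induction t with
  | zero => exact hx
  | succ t ih =>
    have := hN t
    simp only [stateSeq]
    fun_prop

/-- The state at time `t` is a function of `W` and of the noise strictly before `t`. -/
theorem indepFun_stateSeq (hind : iIndepFun (Sum.elim W N : Fin (n + 1) ⊕ ℕ → Ω → ℝ) P)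
    (hW : ∀ i, AEMeasurable (W i) P) (hN : ∀ t, AEMeasurable (N t) P) (t : ℕ) :
    IndepFun (stateVec M c L W N t) (N t) P := by
  classical
  let T : Finset (Fin (n + 1) ⊕ ℕ) := Finset.univ.disjSum (Finset.range t)
  have hWT : ∀ i, (Sum.inl i : Fin (n + 1) ⊕ ℕ) ∈ T := fun i => by simp [T]
  have hdisj : Disjoint T {Sum.inr t} := by simp [T]
  have h1 := hind.indepFun_finset₀ T {Sum.inr t} hdisj (by
    rintro (i | i)
    · exact hW i
    · exact hN i)
  let x : (T → ℝ) → Fin (n + 1) ⊕ Fin m → ℝ :=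
    fun z => Sum.elim (fun i => z ⟨Sum.inl i, hWT i⟩) 0
  -- The default `0` is harmless: by `stateSeq_congr` only times `s < t` matter.
  let N' : ℕ → (T → ℝ) → ℝ := fun s z => if h : (Sum.inr s : Fin (n + 1) ⊕ ℕ) ∈ T then
    z ⟨_, h⟩ else 0
  have hx : Continuous x := by
    refine continuous_pi ?_
    rintro (i | i)
    · exact continuous_apply _
    · exact continuous_const
  have hN' : ∀ s, Continuous (N' s) := by
    intro s
    by_cases h : (Sum.inr s : Fin (n + 1) ⊕ ℕ) ∈ T
    · simp only [N', dif_pos h]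
      exact continuous_apply _
    · simp only [N', dif_neg h]
      exact continuous_const
  have hg : Measurable fun z : T → ℝ => (WithLp.toLp 2 (stateSeq M c L (x z) (fun s => N' s z) t) :
      EuclideanSpace ℝ (Fin (n + 1) ⊕ Fin m)) :=
    ((PiLp.continuous_toLp 2 _).comp (continuous_stateSeq hx hN' t)).measurable
  have h2 := h1.comp hg (measurable_pi_apply
    (⟨Sum.inr t, Finset.mem_singleton_self _⟩ : ({Sum.inr t} : Finset (Fin (n + 1) ⊕ ℕ))))
  convert h2 using 1
  swap
  · rfl
  funext ω
  simp only [Function.comp_apply, x, Sum.elim_inl]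
  refine congrArg (WithLp.toLp 2) (stateSeq_congr _ fun s hs => ?_)
  have hs' : (Sum.inr s : Fin (n + 1) ⊕ ℕ) ∈ T := by simp [T, hs]
  simp [N', dif_pos hs']

theorem aemeasurable_stateSeq (hW : ∀ i, AEMeasurable (W i) P) (hN : ∀ t, AEMeasurable (N t) P)
    (t : ℕ) : AEMeasurable (stateVec M c L W N t) P := by
  have h0 : AEMeasurable (fun ω => (Sum.elim (fun i => W i ω) 0 : Fin (n + 1) ⊕ Fin m → ℝ)) P := by
    refine aemeasurable_pi_iff.2 ?_
    rintro (i | i)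
    · exact hW i
    · exact aemeasurable_const
  suffices h : AEMeasurable (fun ω => stateSeq M c L
      (Sum.elim (fun i => W i ω) (0 : Fin m → ℝ)) (fun s => N s ω) t) P from
    (PiLp.continuous_toLp 2 _).measurable.comp_aemeasurable h
  induction t with
  | zero => exact h0
  | succ t ih =>
    have hc : Measurable fun p : (Fin (n + 1) ⊕ Fin m → ℝ) × ℝ =>
        closedLoop M c (L t) *ᵥ p.1 - p.2 • L t := by
      apply Continuous.measurable
      fun_prop
    have h2 := hc.comp_aemeasurable (ih.prodMk (hN t))
    exact h2

theorem map_stateSeq_prod [IsProbabilityMeasure P]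
    (hind : iIndepFun (Sum.elim W N : Fin (n + 1) ⊕ ℕ → Ω → ℝ) P)
    (hW : ∀ i, HasLaw (W i) (gaussianReal 0 1) P) (hN : ∀ t, HasLaw (N t) (gaussianReal 0 1) P)
    (t : ℕ) :
    P.map (fun ω => (stateVec M c L W N t ω, N t ω)) =
    (P.map (stateVec M c L W N t)).prod (gaussianReal 0 1) := by
  have hW' := fun i => (hW i).aemeasurable
  have hN' := fun t => (hN t).aemeasurable
  rw [(indepFun_iff_map_prod_eq_prod_map_map (aemeasurable_stateSeq hW' hN' t) (hN' t)).1
    (indepFun_stateSeq hind hW' hN' t), (hN t).map_eq]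

/-- The state of the time-varying system is centred Gaussian with the Riccati covariance. -/
theorem charFun_map_stateSeq [IsProbabilityMeasure P]
    (hind : iIndepFun (Sum.elim W N : Fin (n + 1) ⊕ ℕ → Ω → ℝ) P)
    (hW : ∀ i, HasLaw (W i) (gaussianReal 0 1) P) (hN : ∀ t, HasLaw (N t) (gaussianReal 0 1) P)
    (t : ℕ) (w : EuclideanSpace ℝ (Fin (n + 1) ⊕ Fin m)) :
    charFun (P.map (stateVec M c (riccatiGain M c) W N t)) w =
      Complex.exp (-((w.ofLp ⬝ᵥ (riccatiSeq M c (sigmaZero n m) t *ᵥ w.ofLp)) / 2 : ℝ)) := by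
  have hW' := fun i => (hW i).aemeasurable
  have hN' := fun t => (hN t).aemeasurable
  induction t generalizing w with
  | zero =>
    have hindW : iIndepFun W P := hind.precomp (g := Sum.inl) Sum.inl_injective
    have hlaw : P.map (fun ω => (WithLp.toLp 2 (fun i => W i ω) : EuclideanSpace ℝ (Fin (n + 1)))) =
        stdGaussian (EuclideanSpace ℝ (Fin (n + 1))) := by
      rw [← map_pi_eq_stdGaussian]
      have h1 := (iIndepFun_iff_map_fun_eq_pi_map hW').1 hindW
      simp only [fun i => (hW i).map_eq] at h1
      rw [← h1, AEMeasurable.map_map_of_aemeasurable (by fun_prop) (aemeasurable_pi_iff.2 hW')]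
      rfl
    have hWm : AEMeasurable
        (fun ω => (WithLp.toLp 2 (fun i => W i ω) : EuclideanSpace ℝ (Fin (n + 1)))) P :=
      (PiLp.continuous_toLp 2 _).measurable.comp_aemeasurable (aemeasurable_pi_iff.2 hW')
    obtain ⟨a, b, hab⟩ : ∃ a b, w.ofLp = Sum.elim a b := ⟨_, _, (Sum.elim_comp_inl_inr w.ofLp).symm⟩
    have h2 := charFun_stdGaussian (E := EuclideanSpace ℝ (Fin (n + 1))) (WithLp.toLp 2 a)
    rw [← hlaw, charFun_apply, integral_map hWm (by fun_prop)] at h2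
    rw [charFun_apply, integral_map (aemeasurable_stateSeq hW' hN' 0) (by fun_prop)]
    have h3 : ‖(WithLp.toLp 2 a : EuclideanSpace ℝ (Fin (n + 1)))‖ ^ 2 = a ⬝ᵥ a := by
      rw [EuclideanSpace.real_norm_sq_eq]
      simp [dotProduct, sq]
    simp only [EuclideanSpace.inner_eq_star_dotProduct, star_trivial, stateSeq, hab,
      sumElim_dotProduct_sumElim, dotProduct_zero, add_zero, riccatiSeq, sigmaZero,
      Matrix.fromBlocks_mulVec, Sum.elim_comp_inl, Sum.elim_comp_inr, Matrix.one_mulVec,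
      Matrix.zero_mulVec] at h2 ⊢
    rw [h2, ← Complex.ofReal_pow, h3]
    congr 1
    push_cast
    ring
  | succ t ih =>
    have hp := riccatiSeq_posSemidef (M := M) (c := c) (sigmaZero_posSemidef (n := n) (m := m)) t
    set l := gain M c (riccatiSeq M c (sigmaZero n m) t) with hl
    set Y := closedLoop M c l with hY
    have h1 := map_stateSeq_prod (M := M) (c := c)
      (L := riccatiGain M c) hind hW hN t
    have h2 := Measure.isProbabilityMeasure_map (aemeasurable_stateSeq (M := M) (c := c)
      (L := riccatiGain M c) hW' hN' t)
    have h3 := charFun_map_prod_gaussian (P.map (stateVec M c (riccatiGain M c) W N t))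
      (measurable_closedLoop_step Y l) (inner_closedLoop_step Y l w)
    rw [← h1, AEMeasurable.map_map_of_aemeasurable (measurable_closedLoop_step Y l).aemeasurable
      ((aemeasurable_stateSeq hW' hN' t).prodMk (hN' t)), ih, ← Complex.exp_add] at h3
    refine h3.trans ?_
    -- In closed-loop form the Riccati map is exactly the covariance update of the state.
    rw [riccatiSeq, riccatiMap_eq_closedLoop hp.isSymm (innovVar_ne_zero hp), ← hl, ← hY,
      Matrix.add_mulVec, dotProduct_add, dotProduct_conj_mulVec, dotProduct_vecMulVec_mulVec]
    congr 1
    push_cast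
    ring

/-- Every signal is centred Gaussian with variance affine in the Riccati covariance, so the
characteristic functions converge and Lévy's theorem applies. -/
theorem tendstoInDistribution_signals [IsProbabilityMeasure P]
    (hind : iIndepFun (Sum.elim W N : Fin (n + 1) ⊕ ℕ → Ω → ℝ) P)
    (hW : ∀ i, HasLaw (W i) (gaussianReal 0 1) P) (hN : ∀ t, HasLaw (N t) (gaussianReal 0 1) P)
    {S : Matrix (Fin (n + 1) ⊕ Fin m) (Fin (n + 1) ⊕ Fin m) ℝ} (hS : S.PosSemidef)
    (hlim : Tendsto (riccatiSeq M c (sigmaZero n m)) atTop (𝓝 S)) (d : Fin (n + 1) ⊕ Fin m → ℝ) :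
    TendstoInDistribution (fun t ω => stateVec M c (riccatiGain M c) W N t ω)
      atTop id (fun _ => P) (multivariateGaussian 0 S) ∧
    TendstoInDistribution (fun t ω => innovSeq M c (riccatiGain M c)
        (Sum.elim (fun i => W i ω) 0) (fun s => N s ω) t)
      atTop id (fun _ => P) (gaussianReal 0 (innovVar c S).toNNReal) ∧
    TendstoInDistribution (fun t ω => inputSeq M c d (riccatiGain M c)
        (Sum.elim (fun i => W i ω) 0) (fun s => N s ω) t)
      atTop id (fun _ => P) (gaussianReal 0 (d ⬝ᵥ (S *ᵥ d)).toNNReal) := by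
  have hW' := fun i => (hW i).aemeasurable
  have hN' := fun t => (hN t).aemeasurable
  have hXm := aemeasurable_stateSeq (M := M) (c := c) (L := riccatiGain M c) hW' hN'
  have hchar := charFun_map_stateSeq (M := M) (c := c) hind hW hN
  have hquad : ∀ w : Fin (n + 1) ⊕ Fin m → ℝ, Tendsto
      (fun t => w ⬝ᵥ (riccatiSeq M c (sigmaZero n m) t *ᵥ w)) atTop (𝓝 (w ⬝ᵥ (S *ᵥ w))) := by
    intro w
    have hc : Continuous fun S : Matrix (Fin (n + 1) ⊕ Fin m) (Fin (n + 1) ⊕ Fin m) ℝ =>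
        w ⬝ᵥ (S *ᵥ w) := by fun_prop
    exact (hc.tendsto S).comp hlim
  have hexp : Continuous fun r : ℝ => Complex.exp (-(r / 2 : ℝ)) := by fun_prop
  have hdot : ∀ d : Fin (n + 1) ⊕ Fin m → ℝ, Continuous
      fun x : EuclideanSpace ℝ (Fin (n + 1) ⊕ Fin m) => d ⬝ᵥ x.ofLp := fun d => by fun_prop
  refine ⟨tendstoInDistribution_of_charFun hXm fun w => ?_,
    tendstoInDistribution_of_charFun (fun t => ?_) fun s => ?_,
    tendstoInDistribution_of_charFun (fun t => ?_) fun s => ?_⟩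
  · simp_rw [hchar, charFun_multivariateGaussian_zero hS]
    exact (hexp.tendsto _).comp (hquad w.ofLp)
  · exact ((hdot c).measurable.comp_aemeasurable (hXm t)).add (hN' t)
  · have h1 : ∀ t, charFun (P.map fun ω => innovSeq M c (riccatiGain M c)
        (Sum.elim (fun i => W i ω) 0) (fun s => N s ω) t) s =
        Complex.exp (-((s ^ 2 * (c ⬝ᵥ (riccatiSeq M c (sigmaZero n m) t *ᵥ c) + 1)) / 2 : ℝ)) := by
      intro t
      have hg : Measurable fun p : EuclideanSpace ℝ (Fin (n + 1) ⊕ Fin m) × ℝ =>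
          c ⬝ᵥ p.1.ofLp + p.2 := by
        apply Continuous.measurable
        fun_prop
      have h2 := Measure.isProbabilityMeasure_map (hXm t)
      have h3 := charFun_map_prod_gaussian (P.map (stateVec M c (riccatiGain M c) W N t)) hg
        (w := s) (v := WithLp.toLp 2 (s • c)) (b := s) (fun p => by
          simp only [EuclideanSpace.inner_eq_star_dotProduct, star_trivial, smul_dotProduct,
            smul_eq_mul]
          simp [mul_add, mul_comm])
      rw [← map_stateSeq_prod hind hW hN, AEMeasurable.map_map_of_aemeasurable hg.aemeasurable
        ((hXm t).prodMk (hN' t)), hchar, ← Complex.exp_add] at h3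
      refine h3.trans ?_
      simp only [Matrix.mulVec_smul, smul_dotProduct, dotProduct_smul, smul_eq_mul]
      congr 1
      push_cast
      ring
    simp_rw [h1, charFun_gaussianReal_toNNReal (zero_le_one.trans (one_le_innovVar hS))]
    exact (hexp.tendsto _).comp (((hquad c).add_const 1).const_mul (s ^ 2))
  · exact (hdot d).measurable.comp_aemeasurable (hXm t)
  · have h1 : ∀ t, charFun (P.map fun ω => inputSeq M c d (riccatiGain M c)
        (Sum.elim (fun i => W i ω) 0) (fun s => N s ω) t) s =
        Complex.exp (-((s ^ 2 * (d ⬝ᵥ (riccatiSeq M c (sigmaZero n m) t *ᵥ d))) / 2 : ℝ)) := by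
      intro t
      have h3 := hchar t (WithLp.toLp 2 (s • d))
      have hm : AEMeasurable (fun ω => inputSeq M c d (riccatiGain M c)
          (Sum.elim (fun i => W i ω) 0) (fun s => N s ω) t) P :=
        (hdot d).measurable.comp_aemeasurable (hXm t)
      rw [charFun_apply, integral_map (hXm t) (by fun_prop)] at h3
      rw [charFun_apply, integral_map hm (by fun_prop)]
      simp only [EuclideanSpace.inner_eq_star_dotProduct, star_trivial, Matrix.mulVec_smul,
        smul_dotProduct, dotProduct_smul, smul_eq_mul] at h3
      rw [show s ^ 2 * (d ⬝ᵥ (riccatiSeq M c (sigmaZero n m) t *ᵥ d)) =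
        s * (s * (d ⬝ᵥ (riccatiSeq M c (sigmaZero n m) t *ᵥ d))) by ring, ← h3]
      simp [inputSeq]
    simp_rw [h1, charFun_gaussianReal_toNNReal (hS.quad_nonneg d)]
    exact (hexp.tendsto _).comp ((hquad d).const_mul (s ^ 2))

end Signals

end FeedbackKalman

end

/-! ### The main theorem -/

open FeedbackKalman in
theorem mainTheorem9 {n m : ℕ}
    (A : Matrix (Fin (n + 1)) (Fin (n + 1)) ℝ) (C : Fin (n + 1) → ℝ)
    (F : Matrix (Fin m) (Fin m) ℝ) (G H : Fin m → ℝ)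
    (hF : IsSchurStable F) (hFGH : IsSchurStable (F - Matrix.vecMulVec G H))
    (hFG : IsControllable F G) (hFH : IsObservable F H)
    (hAC : IsObservable A C)
    (hA : ∀ z ∈ eigs A, ‖z‖ ≠ 1) (hAF : Disjoint (eigs A) (eigs F)) :
    let M := bigA A C F G
    let c := bigC C H
    let d := bigD m C
    let Sig := riccatiSeq M c (sigmaZero n m)
    ∃ S : Matrix (Fin (n + 1) ⊕ Fin m) (Fin (n + 1) ⊕ Fin m) ℝ,
      -- convergence of the Riccati recursion to the unique stabilizing solution, and its rank
      Tendsto Sig atTop (𝓝 S) ∧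
      S.PosSemidef ∧
      IsStabilizingSolution M c S ∧
      (∀ S', IsStabilizingSolution M c S' → S' = S) ∧
      ((∀ z ∈ eigs A, 1 < ‖z‖) → S.rank = n + 1) ∧
      -- convergence of the coefficients of the time-varying system
      Tendsto (fun t => gain M c (Sig t)) atTop (𝓝 (gain M c S)) ∧
      Tendsto (fun t => innovVar c (Sig t)) atTop (𝓝 (innovVar c S)) ∧
      Tendsto (fun t => closedLoop M c (gain M c (Sig t))) atTop
        (𝓝 (closedLoop M c (gain M c S))) ∧
      -- the steady-state system has exactly one stationary law
      (∀ μ : Measure (EuclideanSpace ℝ (Fin (n + 1) ⊕ Fin m)), IsProbabilityMeasure μ →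
        (IsStationaryLaw M c (gain M c S) μ ↔
          μ = multivariateGaussian 0 S)) ∧
      -- convergence of the signals; `W` and `N` consist of independent standard normal variables
      ∀ (Ω : Type*) [MeasurableSpace Ω] (P : Measure Ω) [IsProbabilityMeasure P]
        (W : Fin (n + 1) → Ω → ℝ) (N : ℕ → Ω → ℝ),
        iIndepFun (Sum.elim W N : Fin (n + 1) ⊕ ℕ → Ω → ℝ) P →
        (∀ i, HasLaw (W i) (gaussianReal 0 1) P) →
        (∀ t, HasLaw (N t) (gaussianReal 0 1) P) →
        let L : ℕ → Fin (n + 1) ⊕ Fin m → ℝ := fun t => gain M c (Sig t)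
        let L' : ℕ → Fin (n + 1) ⊕ Fin m → ℝ := fun _ => gain M c S
        let X₀ : Ω → Fin (n + 1) ⊕ Fin m → ℝ := fun ω => Sum.elim (fun i => W i ω) 0
        -- mean-square convergence to the steady-state system driven by the same noise
        (∀ ξ ξ' : Ω → Fin (n + 1) ⊕ Fin m → ℝ, MemLp ξ 2 P → MemLp ξ' 2 P →
          Tendsto (fun t => eLpNorm (fun ω =>
              stateSeq M c L (ξ ω) (fun s => N s ω) t -
              stateSeq M c L' (ξ' ω) (fun s => N s ω) t) 2 P)
            atTop (𝓝 0) ∧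
          Tendsto (fun t => eLpNorm (fun ω =>
              innovSeq M c L (ξ ω) (fun s => N s ω) t -
              innovSeq M c L' (ξ' ω) (fun s => N s ω) t) 2 P)
            atTop (𝓝 0) ∧
          Tendsto (fun t => eLpNorm (fun ω =>
              inputSeq M c d L (ξ ω) (fun s => N s ω) t -
              inputSeq M c d L' (ξ' ω) (fun s => N s ω) t) 2 P)
            atTop (𝓝 0)) ∧
        -- convergence in distribution to the steady-state distributions
        TendstoInDistribution (fun t ω => WithLp.toLp 2
            (stateSeq M c L (X₀ ω) (fun s => N s ω) t))
          atTop id (fun _ => P) (multivariateGaussian 0 S) ∧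
        TendstoInDistribution (fun t ω =>
            innovSeq M c L (X₀ ω) (fun s => N s ω) t)
          atTop id (fun _ => P) (gaussianReal 0 (innovVar c S).toNNReal) ∧
        TendstoInDistribution (fun t ω =>
            inputSeq M c d L (X₀ ω) (fun s => N s ω) t)
          atTop id (fun _ => P)
            (gaussianReal 0 (d ⬝ᵥ (S *ᵥ d)).toNNReal) := by
  intro M c d Sig
  obtain ⟨L₀, hL₀⟩ := exists_stable_gain (n := n) (G := G) (H := H) hFGH hAC
  -- The block matrix has the eigenvalues of `A`, off the unit circle, and those of `F`, inside it.
  obtain ⟨S, hSp, hS⟩ := exists_isStabilizingSolution hL₀ (by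
    intro z hz
    rw [eigs_bigA] at hz
    exact hz.elim (hA z) fun h => (hF z h).ne)
  have hlim : Tendsto Sig atTop (𝓝 S) :=
    tendsto_riccatiSeq sigmaZero_posSemidef hS (exists_closedProd_bound hF hFGH hAC)
  have hgain : Tendsto (fun t => gain M c (Sig t)) atTop (𝓝 (gain M c S)) :=
    (continuousAt_gain hS.denom).tendsto.comp hlim
  refine ⟨S, hlim, hSp, hS, fun S' hS' => hS'.unique hS, fun h => rank_eq_of_antistable hF h hSp hS,
    hgain, (continuous_innovVar.tendsto S).comp hlim,
    (continuous_closedLoop.tendsto _).comp hgain,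
    fun μ _ => isStationaryLaw_iff hSp hS μ, ?_⟩
  intro Ω _ P _ W N hind hW hN L L' X₀
  exact ⟨fun ξ ξ' hξ hξ' => tendsto_eLpNorm_sub hS.stable hgain hN d hξ hξ',
    tendstoInDistribution_signals hind hW hN hSp hlim d⟩
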